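/- **Setting.** Let $f:\mathbb R\to\mathbb R$ be a compactly supported function of bounded variation, i.e. $\sup\sum_p|f(x_{p+1})-f(x_p)|<\infty$ over all finite partitions of $\mathbb R$, all of whose discontinuities are jumps: $f(x-)\neq f(x+)$ for the one-sided limits at every point $x$ at which $f$ is not continuous. Let $\Xi\in C_c^\infty(\mathbb R^2)$ (complex-valued) be equal to $1$ in a neighbourhood of $\operatorname{supp}(f)\times\{0\}$. Let $\mathrm df$ denote the Lebesgue–Stieltjes signed measure of $f$, determined by $\mathrm df([a,b])=f(b+)-f(a-)$, and define the complex Borel measure $\zeta_f$ on $\mathbb R^2$ by $$\mathrm d\zeta_f(x,y):=\mathrm df(x)\,\mathrm dy\,\Xi(x,y)+\mathrm dx\,\mathrm dy\,f(x)\,(\partial_x+i\partial_y)\Xi(x,y),$$ with total variation measure $|\zeta_f|$. Let $K$ be a (possibly unbounded) self-adjoint operator on a complex Hilbert space $\mathcal H$, with resolvent $R_z(K):=(K-z)^{-1}$, and let $A,B$ be bounded operators on $\mathcal H$. Let $f(K)=\int f\,\mathrm dE$ be given by the Borel functional calculus, where $E$ is the projection-valued spectral measure of $K$. (The line $y=0$,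 where the resolvent may fail to exist, is a $|\zeta_f|$-null set.) **Lemma.** If $$\int_{\mathbb R^2}\mathrm d|\zeta_f|(x,y)\,\bigl\|A\,R_{x+iy}(K)\,B\bigr\|<\infty,$$ then $(x,y)\mapsto A\,R_{x+iy}(K)\,B$ is Bochner integrable with respect to $|\zeta_f|$ in the operator norm, and $$A\,f(K)\,B=\frac1{2\pi}\int_{\mathbb R^2}\mathrm d\zeta_f(x,y)\,A\,R_{x+iy}(K)\,B .$$ -/

import Mathlib

open MeasureTheory Set Filter Topology
open scoped ContDiff

noncomputable section

/-! ### Self-adjoint operators: resolvent, spectral measure, Borel functional calculus -/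

section Operators

variable {H : Type*} [NormedAddCommGroup H] [InnerProductSpace ℂ H]

/-- `R` is a bounded two-sided inverse of `K - z : dom K → H`, where `K` is a possibly unbounded
operator. -/
def IsResolventAt (K : H →ₗ.[ℂ] H) (z : ℂ) (R : H →L[ℂ] H) : Prop :=
  (∀ ψ : H, ∃ h : R ψ ∈ K.domain, K ⟨R ψ, h⟩ - z • R ψ = ψ) ∧
    ∀ ψ : K.domain, R (K ψ - z • (ψ : H)) = ψ

open scoped Classical in
/-- The resolvent `R_z(K) = (K - z)⁻¹` for `z` in the resolvent set of `K`; it is set to be `0` at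
the points `z` of the spectrum. -/
def resolventOp (K : H →ₗ.[ℂ] H) (z : ℂ) : H →L[ℂ] H :=
  if h : ∃ R : H →L[ℂ] H, IsResolventAt K z R then h.choose else 0

variable [CompleteSpace H]

/-- A projection-valued measure on the Borel sets of `ℝ`, countably additive in the strong operator
topology. (The values at sets that are not Borel play no role.) -/
structure ProjectionValuedMeasure (H : Type*) [NormedAddCommGroup H] [InnerProductSpace ℂ H]
    [CompleteSpace H] where
  proj : Set ℝ → H →L[ℂ] H
  isStarProjection : ∀ s, MeasurableSet s → IsStarProjection (proj s)
  proj_univ : proj univ = 1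
  proj_inter : ∀ s t, MeasurableSet s → MeasurableSet t → proj (s ∩ t) = proj s * proj t
  hasSum_iUnion : ∀ s : ℕ → Set ℝ, (∀ n, MeasurableSet (s n)) →
    Pairwise (Function.onFun Disjoint s) →
    ∀ ψ : H, HasSum (fun n => proj (s n) ψ) (proj (⋃ n, s n) ψ)

namespace ProjectionValuedMeasure

variable (E : ProjectionValuedMeasure H)

lemma proj_empty : E.proj ∅ = 0 := by
  ext ψ
  have h := (E.hasSum_iUnion (fun _ => ∅) (fun _ => .empty) (fun _ _ _ => by
    simp [Function.onFun]) ψ).summable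
  simpa using (summable_const_iff _).1 h

lemma re_inner_nonneg {s : Set ℝ} (hs : MeasurableSet s) (ψ : H) :
    0 ≤ (inner ℂ ψ (E.proj s ψ)).re :=
  (ContinuousLinearMap.IsPositive.of_isStarProjection
    (E.isStarProjection s hs)).re_inner_nonneg_right ψ

/-- The finite positive Borel measure `s ↦ ⟨ψ, E(s) ψ⟩`. -/
def measure (ψ : H) : Measure ℝ :=
  Measure.ofMeasurable (fun s _ => ENNReal.ofReal (inner ℂ ψ (E.proj s ψ)).re)
    (by simp [E.proj_empty])
    (by
      intro s hs hd
      have h : HasSum (fun n => (inner ℂ ψ (E.proj (s n) ψ)).re)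
          (inner ℂ ψ (E.proj (⋃ n, s n) ψ)).re :=
        ((Complex.reCLM.comp ((innerSL ℂ ψ).restrictScalars ℝ)).hasSum
          (E.hasSum_iUnion s hs hd ψ))
      rw [← h.tsum_eq]
      exact ENNReal.ofReal_tsum_of_nonneg (fun n => E.re_inner_nonneg (hs n) ψ) h.summable)

lemma measure_apply (ψ : H) {s : Set ℝ} (hs : MeasurableSet s) :
    E.measure ψ s = ENNReal.ofReal (inner ℂ ψ (E.proj s ψ)).re :=
  Measure.ofMeasurable_apply s hs

/-- `E` is the spectral measure of `K`, i.e. `K = ∫ λ dE(λ)`: the domain of `K` consists of all `ψ`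
with `∫ λ² d⟨ψ, E(λ) ψ⟩ < ∞`, and `⟨ψ, K ψ⟩ = ∫ λ d⟨ψ, E(λ) ψ⟩` for all these `ψ`. -/
def IsSpectralMeasureOf (K : H →ₗ.[ℂ] H) : Prop :=
  (∀ ψ : H, ψ ∈ K.domain ↔ Integrable (fun l : ℝ => l ^ 2) (E.measure ψ)) ∧
    ∀ ψ : K.domain, inner ℂ (ψ : H) (K ψ) = ∫ l, (l : ℂ) ∂(E.measure ψ)

open scoped Classical in
/-- The integral `∫ f dE` of a function `f` with respect to a projection-valued measure, when it
defines a bounded operator: the unique bounded operator `T` with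
`⟨ψ, T ψ⟩ = ∫ f(λ) d⟨ψ, E(λ) ψ⟩` for all `ψ`. It exists if `f` is bounded and measurable. -/
def integral (f : ℝ → ℂ) : H →L[ℂ] H :=
  if h : ∃ T : H →L[ℂ] H, ∀ ψ : H,
      Integrable f (E.measure ψ) ∧ inner ℂ ψ (T ψ) = ∫ l, f l ∂(E.measure ψ)
  then h.choose else 0

end ProjectionValuedMeasure

open scoped Classical in
/-- The Borel functional calculus `f(K) = ∫ f dE`, where `E` is the spectral measure of the
self-adjoint operator `K`. -/
def borelFunction (K : H →ₗ.[ℂ] H) (f : ℝ → ℂ) : H →L[ℂ] H :=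
  if h : ∃ E : ProjectionValuedMeasure H, E.IsSpectralMeasureOf K then h.choose.integral f else 0

end Operators

/-! ### The complex measure `ζ_f` -/

/-- The Lebesgue-Stieltjes signed measure `df`, with `df([a, b]) = f(b+) - f(a-)`, is
`hf.vectorMeasure`; the product `df(x) dy Ξ(x, y)` is formed by splitting `df` into its positive
and its negative part. -/
def stieltjesProdMeasure {f : ℝ → ℝ} (hf : BoundedVariationOn f univ) (Ξ : ℝ × ℝ → ℂ) :
    ComplexMeasure (ℝ × ℝ) :=
  ((SignedMeasure.toJordanDecomposition hf.vectorMeasure).posPart.prod volume).withDensityᵥ Ξ -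
    ((SignedMeasure.toJordanDecomposition hf.vectorMeasure).negPart.prod volume).withDensityᵥ Ξ

/-- The complex Borel measure
`dζ_f(x, y) = df(x) dy Ξ(x, y) + dx dy f(x) (∂ₓ + i ∂_y) Ξ(x, y)` on `ℝ²`. -/
def zetaMeasure {f : ℝ → ℝ} (hf : BoundedVariationOn f univ) (Ξ : ℝ × ℝ → ℂ) :
    ComplexMeasure (ℝ × ℝ) :=
  stieltjesProdMeasure hf Ξ +
    (volume : Measure (ℝ × ℝ)).withDensityᵥ (fun p =>
      (f p.1 : ℂ) * (fderiv ℝ Ξ p (1, 0) + Complex.I * fderiv ℝ Ξ p (0, 1)))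

/-- Integral of a Banach space valued function with respect to a complex measure. -/
def complexMeasureIntegral {X V : Type*} [MeasurableSpace X] [NormedAddCommGroup V]
    [NormedSpace ℂ V] (ζ : ComplexMeasure X) (F : X → V) : V :=
  ζ.integral F (ContinuousLinearMap.lsmul ℝ ℂ : ℂ →L[ℝ] V →L[ℝ] V).flip

/-- Every discontinuity of `f` is a jump: the one-sided limits are different there. -/
def HasOnlyJumpDiscontinuities (f : ℝ → ℝ) : Prop :=
  ∀ x, ¬ ContinuousAt f x → Function.leftLim f x ≠ Function.rightLim f x

end

/-! ### Resolvents of self-adjoint operators. -/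

section Resolvent

variable {H : Type*} [NormedAddCommGroup H] [InnerProductSpace ℂ H]

/-! Cut the integral off at `|y| > ε` and look at the scalar kernel `k = (l - x - iy)⁻¹`. Since `(∂ₓ
+ i∂_y) k = 0`, integrating by parts in `x` (against `df`) and in `y` leaves only the boundary terms
at `y = ±ε`. Near `supp f` one has `Ξ = 1`, and the jump of `k` across the strip is a Poisson
kernel, so the cut off integral is twice the Poisson integral of `f` (`cutoffIntegral_eq`). It is
bounded uniformly in `ε` and `l`, and tends to `2π g(l)` with `g(l) = (f(l+) + f(l-)) / 2`
(`tendsto_poissonIntegral`).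

The spectral theorem carries this over to operators: the cut off integrals of the resolvent tend
weakly to `2π g(K)` (`tendsto_inner_cutoffOperator`). Between `A` and `B`, the integrability
hypothesis makes the same integrals converge in norm to the full integral. Comparing the limits
gives the formula with `g` in place of `f` (`comp_limAverage_comp_eq`).

It remains to see that `A (f - g)(K) B = 0`. The functions differ at most at the countably many
discontinuities of `f`. At a jump `x`, the measure `ζ_f` charges the vertical line through `x` with
a nonzero multiple of `dy`, so `‖A R_{x+iy} B‖` is integrable near `y = 0`. But `-iy R_{x+iy}` tends
weakly to `E({x})`, so `A E({x}) B ≠ 0` would force a lower bound `c/y`, which is not integrable.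
Hence `A E({x}) B = 0` (`comp_proj_singleton_comp_eq_zero`), and countable additivity of `E`
finishes the proof (`comp_isIntegral_comp_eq_zero`).

The existence of `E` (`exists_isSpectralMeasureOf`) comes from the continuous functional calculus of
the bounded normal operator `(K + i)⁻¹`. -/

lemma IsResolventAt.unique {K : H →ₗ.[ℂ] H} {z : ℂ} {R S : H →L[ℂ] H}
    (hR : IsResolventAt K z R) (hS : IsResolventAt K z S) : R = S := by
  ext ψ
  obtain ⟨h, e⟩ := hR.1 ψ
  have := hS.2 ⟨R ψ, h⟩
  rw [e] at this
  exact this.symm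

lemma resolventOp_eq {K : H →ₗ.[ℂ] H} {z : ℂ} {R : H →L[ℂ] H}
    (hR : IsResolventAt K z R) : resolventOp K z = R := by
  have h : ∃ R : H →L[ℂ] H, IsResolventAt K z R := ⟨R, hR⟩
  rw [resolventOp, dif_pos h]
  exact h.choose_spec.unique hR

/-- First resolvent identity: apply `R` to `ψ = (K - z) Sψ + (z - w) Sψ`. -/
lemma IsResolventAt.sub_eq {K : H →ₗ.[ℂ] H} {z w : ℂ} {R S : H →L[ℂ] H}
    (hR : IsResolventAt K z R) (hS : IsResolventAt K w S) :
    R - S = (z - w) • (R ∘L S) := by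
  ext ψ
  obtain ⟨h, e⟩ := hS.1 ψ
  have := hR.2 ⟨S ψ, h⟩
  have e2 : ψ = K ⟨S ψ, h⟩ - z • S ψ + (z - w) • S ψ := by
    rw [sub_smul]; nth_rw 1 [← e]; abel
  have e3 : R ψ = S ψ + (z - w) • R (S ψ) := by
    nth_rw 1 [e2]
    rw [map_add, this, map_smul]
  simp [e3]

variable [CompleteSpace H]

lemma IsSelfAdjoint.inner_apply_eq {K : H →ₗ.[ℂ] H} (hK : IsSelfAdjoint K) (φ ψ : K.domain) :
    inner ℂ (K φ) (ψ : H) = inner ℂ (φ : H) (K ψ) := by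
  have h := K.adjoint_isFormalAdjoint hK.dense_domain
  rw [LinearPMap.isSelfAdjoint_def.1 hK] at h
  exact h φ ψ

/-- `⟨ψ, Kψ⟩` is real, so the imaginary part of `⟨ψ, (K - z)ψ⟩` comes from `z` alone; conclude by
Cauchy–Schwarz. -/
lemma IsSelfAdjoint.abs_im_mul_norm_le {K : H →ₗ.[ℂ] H} (hK : IsSelfAdjoint K) (z : ℂ)
    (ψ : K.domain) : |z.im| * ‖(ψ : H)‖ ≤ ‖K ψ - z • (ψ : H)‖ := by
  rcases eq_or_ne (ψ : H) 0 with h0 | h0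
  · simp [h0]
  have hpos : 0 < ‖(ψ : H)‖ := norm_pos_iff.2 h0
  have him : (inner ℂ (ψ : H) (K ψ)).im = 0 := by
    have h1 := hK.inner_apply_eq ψ ψ
    have h2 := inner_conj_symm (𝕜 := ℂ) (ψ : H) (K ψ)
    rw [h1] at h2
    exact Complex.conj_eq_iff_im.1 h2
  have h3 : (inner ℂ (ψ : H) (K ψ - z • (ψ : H))).im = - (z.im * ‖(ψ : H)‖ ^ 2) := by
    rw [inner_sub_right, inner_smul_right, inner_self_eq_norm_sq_to_K, Complex.sub_im, him]
    have : ((‖(ψ : H)‖ : ℂ) ^ 2) = ((‖(ψ : H)‖ ^ 2 : ℝ) : ℂ) := by push_cast; rfl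
    simp [this, Complex.mul_im, -Complex.ofReal_pow]
  have h4 : |z.im| * ‖(ψ : H)‖ ^ 2 ≤ ‖(ψ : H)‖ * ‖K ψ - z • (ψ : H)‖ := by
    calc |z.im| * ‖(ψ : H)‖ ^ 2 = |(inner ℂ (ψ : H) (K ψ - z • (ψ : H))).im| := by
          rw [h3, abs_neg, abs_mul, abs_of_nonneg (sq_nonneg ‖(ψ : H)‖)]
      _ ≤ _ := (Complex.abs_im_le_norm _).trans (norm_inner_le_norm _ _)
  nlinarith

/-- The lower bound for `K - z` makes it injective and, `K` being closed, gives it closed range. A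
vector orthogonal to the range lies in the domain of the adjoint, which is `K`, and is an
eigenvector for the conjugate of `z`; the lower bound there makes it zero. -/
lemma IsSelfAdjoint.exists_isResolventAt {K : H →ₗ.[ℂ] H} (hK : IsSelfAdjoint K) {z : ℂ}
    (hz : z.im ≠ 0) : ∃ R : H →L[ℂ] H, IsResolventAt K z R ∧ ‖R‖ ≤ |z.im|⁻¹ := by
  have hz' : 0 < |z.im| := abs_pos.2 hz
  let T : K.domain →ₗ[ℂ] H := K.toFun - z • K.domain.subtype
  have hT (ψ : K.domain) : T ψ = K ψ - z • (ψ : H) := rfl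
  have hlow (ψ : K.domain) : |z.im| * ‖(ψ : H)‖ ≤ ‖T ψ‖ := hK.abs_im_mul_norm_le z ψ
  have hinj : Function.Injective T := by
    rw [injective_iff_map_eq_zero]
    intro ψ hψ
    have h := hlow ψ
    rw [hψ, norm_zero] at h
    have : ‖(ψ : H)‖ = 0 := le_antisymm (by nlinarith [norm_nonneg (ψ : H)]) (norm_nonneg _)
    exact Subtype.ext (norm_eq_zero.1 this)
  have hclosed : IsClosed (LinearMap.range T : Set H) := by
    refine isClosed_of_closure_subset fun η hη => ?_
    obtain ⟨u, hu, hlim⟩ := mem_closure_iff_seq_limit.1 hη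
    choose ψ hψ using hu
    have hcau : CauchySeq fun n => ((ψ n : K.domain) : H) := by
      have hcu := hlim.cauchySeq
      rw [Metric.cauchySeq_iff'] at hcu ⊢
      intro ε hε
      obtain ⟨N, hN⟩ := hcu (|z.im| * ε) (by positivity)
      refine ⟨N, fun n hn => ?_⟩
      have h1 := hN n hn
      rw [dist_eq_norm, ← hψ n, ← hψ N, ← map_sub] at h1
      have h2 := (hlow (ψ n - ψ N)).trans_lt h1
      rw [dist_eq_norm]
      exact lt_of_mul_lt_mul_left h2 hz'.le
    obtain ⟨χ, hχ⟩ := cauchySeq_tendsto_of_complete hcau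
    have hKlim : Tendsto (fun n => K (ψ n)) atTop (𝓝 (η + z • χ)) := by
      have : (fun n => K (ψ n)) = fun n => u n + z • (ψ n : H) := by
        ext n; rw [← hψ n, hT]; abel
      rw [this]
      exact hlim.add (hχ.const_smul z)
    have hmem : (χ, η + z • χ) ∈ K.graph := by
      have hcl : IsClosed (K.graph : Set (H × H)) := hK.isClosed
      exact hcl.mem_of_tendsto (hχ.prodMk_nhds hKlim)
        (Eventually.of_forall fun n => K.mem_graph (ψ n))
    obtain ⟨y, hy1, hy2⟩ := (LinearPMap.mem_graph_iff K).1 hmem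
    exact ⟨y, by rw [hT, hy2, hy1]; simp⟩
  have htop : LinearMap.range T = ⊤ := by
    have : CompleteSpace (LinearMap.range T) := hclosed.completeSpace_coe
    rw [← Submodule.orthogonal_eq_bot_iff, Submodule.eq_bot_iff]
    intro χ hχ
    have h0 (ψ : K.domain) : inner ℂ (star z • χ) (ψ : H) = inner ℂ χ (K ψ) := by
      have h1 := (Submodule.mem_orthogonal' _ _).1 hχ (T ψ) ⟨ψ, rfl⟩
      rw [hT, inner_sub_right, inner_smul_right, sub_eq_zero] at h1
      rw [h1, inner_smul_left]
      simp
    have hdom : χ ∈ K.adjoint.domain := LinearPMap.mem_adjoint_domain_of_exists _ ⟨_, h0⟩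
    have happ := LinearPMap.adjoint_apply_eq hK.dense_domain ⟨χ, hdom⟩ h0
    have hgr : (χ, star z • χ) ∈ K.graph := by
      rw [← LinearPMap.isSelfAdjoint_def.1 hK, LinearPMap.mem_graph_iff]
      exact ⟨⟨χ, hdom⟩, rfl, happ⟩
    obtain ⟨y, hy1, hy2⟩ := (LinearPMap.mem_graph_iff K).1 hgr
    have h2 := hK.abs_im_mul_norm_le (star z) y
    rw [hy2, hy1, sub_self, norm_zero] at h2
    have him : |(star z).im| = |z.im| := by simp
    rw [him] at h2
    exact norm_eq_zero.1 (le_antisymm (by nlinarith [norm_nonneg χ]) (norm_nonneg _))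
  let e : K.domain ≃ₗ[ℂ] H := LinearEquiv.ofBijective T ⟨hinj, LinearMap.range_eq_top.1 htop⟩
  have he (ψ : K.domain) : e ψ = T ψ := rfl
  let R : H →L[ℂ] H := (K.domain.subtype ∘ₗ e.symm.toLinearMap).mkContinuous |z.im|⁻¹ fun η => by
    have h := hlow (e.symm η)
    rw [← he, e.apply_symm_apply] at h
    rw [inv_mul_eq_div, le_div_iff₀' hz']
    exact h
  have hR (η : H) : R η = (e.symm η : K.domain) := rfl
  refine ⟨R, ⟨fun η => ⟨(e.symm η).2, ?_⟩, fun ψ => ?_⟩,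
    LinearMap.mkContinuous_norm_le _ (by positivity) _⟩
  · have : T (e.symm η) = η := e.apply_symm_apply η
    exact this
  · rw [hR, ← hT, ← he, e.symm_apply_apply]

lemma IsSelfAdjoint.isResolventAt {K : H →ₗ.[ℂ] H} (hK : IsSelfAdjoint K) {z : ℂ}
    (hz : z.im ≠ 0) : IsResolventAt K z (resolventOp K z) := by
  obtain ⟨R, hR, -⟩ := hK.exists_isResolventAt hz
  rwa [resolventOp_eq hR]

lemma IsSelfAdjoint.norm_resolventOp_le {K : H →ₗ.[ℂ] H} (hK : IsSelfAdjoint K) {z : ℂ}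
    (hz : z.im ≠ 0) : ‖resolventOp K z‖ ≤ |z.im|⁻¹ := by
  obtain ⟨R, hR, hn⟩ := hK.exists_isResolventAt hz
  rwa [resolventOp_eq hR]

lemma IsSelfAdjoint.continuousOn_resolventOp {K : H →ₗ.[ℂ] H} (hK : IsSelfAdjoint K) :
    ContinuousOn (resolventOp K) {z | z.im ≠ 0} := by
  intro z hz
  have hopen : {z : ℂ | z.im ≠ 0} ∈ 𝓝 z :=
    (isOpen_ne_fun Complex.continuous_im continuous_const).mem_nhds hz
  refine ContinuousAt.continuousWithinAt ?_
  rw [ContinuousAt, tendsto_iff_norm_sub_tendsto_zero]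
  have hb : Tendsto (fun w : ℂ => ‖w - z‖ * (|w.im|⁻¹ * |z.im|⁻¹)) (𝓝 z) (𝓝 0) := by
    have : ContinuousAt (fun w : ℂ => ‖w - z‖ * (|w.im|⁻¹ * |z.im|⁻¹)) z := by
      have hz' : |z.im| ≠ 0 := abs_ne_zero.2 hz
      exact ContinuousAt.mul (by fun_prop) (ContinuousAt.mul
        (ContinuousAt.inv₀ (by fun_prop) hz') continuousAt_const)
    simpa [ContinuousAt] using this
  refine squeeze_zero' (Eventually.of_forall fun _ => norm_nonneg _) ?_ hb
  filter_upwards [hopen] with w hw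
  rw [(hK.isResolventAt hw).sub_eq (hK.isResolventAt hz), norm_smul]
  gcongr
  exact (ContinuousLinearMap.opNorm_comp_le _ _).trans
    (mul_le_mul (hK.norm_resolventOp_le hw) (hK.norm_resolventOp_le hz) (norm_nonneg _)
      (by positivity))

lemma IsSelfAdjoint.adjoint_resolventOp {K : H →ₗ.[ℂ] H} (hK : IsSelfAdjoint K) {z : ℂ}
    (hz : z.im ≠ 0) :
    ContinuousLinearMap.adjoint (resolventOp K z) = resolventOp K (star z) := by
  have hz' : (star z).im ≠ 0 := by simpa using hz
  symm
  rw [ContinuousLinearMap.eq_adjoint_iff]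
  intro φ ψ
  obtain ⟨h1, e1⟩ := (hK.isResolventAt hz').1 φ
  obtain ⟨h2, e2⟩ := (hK.isResolventAt hz).1 ψ
  have := hK.inner_apply_eq ⟨_, h1⟩ ⟨_, h2⟩
  nth_rw 1 [← e2]
  conv_rhs => rw [← e1]
  rw [inner_sub_left, inner_sub_right, this, inner_smul_left, inner_smul_right]
  simp

end Resolvent

/-! ### Weak limits of operators through their quadratic forms. -/

section WeakLimit

variable {H : Type*} [NormedAddCommGroup H] [InnerProductSpace ℂ H]

lemma inner_apply_polarization (T : H →L[ℂ] H) (φ ψ : H) :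
    inner ℂ φ (T ψ) =
      (inner ℂ (φ + ψ) (T (φ + ψ)) - inner ℂ (φ - ψ) (T (φ - ψ)) -
          Complex.I * inner ℂ (φ + Complex.I • ψ) (T (φ + Complex.I • ψ)) +
          Complex.I * inner ℂ (φ - Complex.I • ψ) (T (φ - Complex.I • ψ))) / 4 := by
  simp only [map_add, map_sub, inner_add_left, inner_add_right, map_smul, inner_smul_left,
    inner_smul_right, Complex.conj_I, inner_sub_left, inner_sub_right]
  linear_combination ((inner ℂ φ (T ψ) - inner ℂ ψ (T φ)) / 2) * Complex.I_sq

lemma ContinuousLinearMap.ext_inner_self {S T : H →L[ℂ] H}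
    (h : ∀ ψ, inner ℂ ψ (S ψ) = inner ℂ ψ (T ψ)) : S = T := by
  ext ψ
  refine ext_inner_left ℂ fun φ => ?_
  rw [inner_apply_polarization S, inner_apply_polarization T, h, h, h, h]

lemma tendsto_inner_apply_of_tendsto_inner_self {ι : Type*} {l : Filter ι}
    {T : ι → H →L[ℂ] H} {S : H →L[ℂ] H}
    (h : ∀ ψ, Tendsto (fun n => inner ℂ ψ (T n ψ)) l (𝓝 (inner ℂ ψ (S ψ)))) (φ ψ : H) :
    Tendsto (fun n => inner ℂ φ (T n ψ)) l (𝓝 (inner ℂ φ (S ψ))) := by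
  simp_rw [inner_apply_polarization _ φ ψ]
  exact (((((h _).sub (h _)).sub ((h _).const_mul _)).add ((h _).const_mul _)).div_const _)

variable [CompleteSpace H]

/-- A sequence of bounded operators whose quadratic forms converge pointwise converges weakly to
a bounded operator. -/
lemma exists_tendsto_inner_self {T : ℕ → H →L[ℂ] H} {q : H → ℂ}
    (h : ∀ ψ, Tendsto (fun n => inner ℂ ψ (T n ψ)) atTop (𝓝 (q ψ))) :
    ∃ S : H →L[ℂ] H, ∀ ψ, inner ℂ ψ (S ψ) = q ψ := by
  have hlim (φ ψ : H) : ∃ c, Tendsto (fun n => inner ℂ φ (T n ψ)) atTop (𝓝 c) := by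
    simp_rw [inner_apply_polarization _ φ ψ]
    exact ⟨_, ((((h _).sub (h _)).sub ((h _).const_mul _)).add ((h _).const_mul _)).div_const _⟩
  choose b hb using hlim
  -- Uniform boundedness is used twice: weak convergence bounds each orbit `T n ψ`, and bounded
  -- orbits bound the norms of the `T n`.
  have hbdd (ψ : H) : ∃ C, ∀ n, ‖T n ψ‖ ≤ C := by
    obtain ⟨C, hC⟩ := banach_steinhaus (g := fun n => innerSL ℂ (T n ψ)) fun φ => by
      obtain ⟨C, hC⟩ := (hb φ ψ).norm.bddAbove_range
      exact ⟨C, fun n => by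
        rw [innerSL_apply_apply, norm_inner_symm]; exact hC (mem_range_self n)⟩
    exact ⟨C, fun n => by simpa using hC n⟩
  obtain ⟨C, hC⟩ := banach_steinhaus hbdd
  have hbd (φ ψ : H) : ‖b φ ψ‖ ≤ C * ‖φ‖ * ‖ψ‖ := by
    refine le_of_tendsto (hb φ ψ).norm (Eventually.of_forall fun n => ?_)
    calc ‖inner ℂ φ (T n ψ)‖ ≤ ‖φ‖ * ‖T n ψ‖ := norm_inner_le_norm _ _
      _ ≤ ‖φ‖ * (C * ‖ψ‖) := by gcongr; exact (T n).le_of_opNorm_le (hC n) ψ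
      _ = _ := by ring
  let B : H →ₗ⋆[ℂ] H →ₗ[ℂ] ℂ := LinearMap.mk₂'ₛₗ (starRingEnd ℂ) (RingHom.id ℂ) b
    (fun φ φ' ψ => tendsto_nhds_unique (hb _ _) <| by
      simpa only [inner_add_left] using (hb φ ψ).add (hb φ' ψ))
    (fun c φ ψ => tendsto_nhds_unique (hb _ _) <| by
      simpa only [inner_smul_left, smul_eq_mul] using (hb φ ψ).const_mul (starRingEnd ℂ c))
    (fun φ ψ ψ' => tendsto_nhds_unique (hb _ _) <| by
      simpa only [inner_add_right, map_add] using (hb φ ψ).add (hb φ ψ'))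
    (fun c φ ψ => tendsto_nhds_unique (hb _ _) <| by
      simpa only [inner_smul_right, map_smul, smul_eq_mul, RingHom.id_apply] using (hb φ ψ).const_mul c)
  let B' : H →L⋆[ℂ] H →L[ℂ] ℂ := B.mkContinuous₂ C fun φ ψ => hbd φ ψ
  let S := InnerProductSpace.continuousLinearMapOfBilin B'
  refine ⟨ContinuousLinearMap.adjoint S, fun ψ => ?_⟩
  rw [ContinuousLinearMap.adjoint_inner_right, InnerProductSpace.continuousLinearMapOfBilin_apply]
  exact tendsto_nhds_unique (hb ψ ψ) (h ψ)

end WeakLimit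

/-! ### Measures and set operators of a representation of `C(X, ℂ)`. -/

section CompactSpectralMeasure

variable {H : Type*} [NormedAddCommGroup H] [InnerProductSpace ℂ H] [CompleteSpace H]
  {X : Type*} [MetricSpace X]

/-- The continuous complex-valued function underlying a continuous real-valued function. -/
def ContinuousMap.toComplex {Y : Type*} [TopologicalSpace Y] (g : C(Y, ℝ)) : C(Y, ℂ) :=
  ⟨fun x => (g x : ℂ), by fun_prop⟩

lemma ContinuousMap.toComplex_apply {Y : Type*} [TopologicalSpace Y] (g : C(Y, ℝ)) (x : Y) :
    g.toComplex x = (g x : ℂ) := rfl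

lemma StarAlgHom.inner_apply_eq (Φ : C(X, ℂ) →⋆ₐ[ℂ] (H →L[ℂ] H)) (g h : C(X, ℂ)) (φ ψ : H) :
    inner ℂ (Φ g φ) (Φ h ψ) = inner ℂ φ (Φ (star g * h) ψ) := by
  rw [map_mul, map_star, mul_apply_eq_comp, ContinuousLinearMap.star_eq_adjoint,
    ContinuousLinearMap.adjoint_inner_right]

variable [MeasurableSpace X]

variable {Φ : C(X, ℂ) →⋆ₐ[ℂ] (H →L[ℂ] H)} {ν : H → Measure X}

/-- The family of measures `ν` represents the quadratic forms of the operators `Φ g`. -/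
def IsSpectralFamily (Φ : C(X, ℂ) →⋆ₐ[ℂ] (H →L[ℂ] H)) (ν : H → Measure X) : Prop :=
  ∀ ψ, IsFiniteMeasure (ν ψ) ∧ ∀ g : C(X, ℂ), inner ℂ ψ (Φ g ψ) = ∫ x, g x ∂(ν ψ)

/-- The operator `S` represents the multiplication by `g` on continuous functions. -/
def Represents (Φ : C(X, ℂ) →⋆ₐ[ℂ] (H →L[ℂ] H)) (ν : H → Measure X) (g : X → ℂ)
    (S : H →L[ℂ] H) : Prop :=
  ∀ ψ, Integrable g (ν ψ) ∧ ∀ h : C(X, ℂ), inner ℂ ψ (S (Φ h ψ)) = ∫ x, g x * h x ∂(ν ψ)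

lemma Represents.inner_self {g : X → ℂ} {S : H →L[ℂ] H} (h : Represents Φ ν g S) (ψ : H) :
    inner ℂ ψ (S ψ) = ∫ x, g x ∂(ν ψ) := by
  have := (h ψ).2 1
  simpa using this

variable [BorelSpace X]

/-- The indicator of a closed set is a bounded pointwise limit of continuous functions, so `T` is a
weak limit of operators `Φ (a n)`. The conclusion is tested against all represented `S`, not only `S
= 1`, because this is what later yields products of set operators. -/
lemma IsSpectralFamily.exists_setOperator_of_isClosed (hν : IsSpectralFamily Φ ν) {t : Set X}
    (ht : IsClosed t) : ∃ T : H →L[ℂ] H, ∀ g S, Represents Φ ν g S →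
      ∀ ψ, inner ℂ ψ (S (T ψ)) = ∫ x in t, g x ∂(ν ψ) := by
  let a (n : ℕ) : C(X, ℂ) :=
    ContinuousMap.toComplex ⟨fun x => (ht.apprSeq n x : ℝ), by fun_prop⟩
  have ha_apply (n : ℕ) (x : X) : a n x = ((ht.apprSeq n x : ℝ) : ℂ) := rfl
  have ha_norm (n : ℕ) (x : X) : ‖a n x‖ ≤ 1 := by
    rw [ha_apply, Complex.norm_real, Real.norm_of_nonneg (NNReal.coe_nonneg _)]
    exact_mod_cast HasOuterApproxClosed.apprSeq_apply_le_one ht n x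
  have ha_lim (x : X) : Tendsto (fun n => a n x) atTop (𝓝 (t.indicator 1 x)) := by
    have h := tendsto_pi_nhds.1 (HasOuterApproxClosed.tendsto_apprSeq ht) x
    have h' := (Complex.continuous_ofReal.comp NNReal.continuous_coe).tendsto
      (t.indicator (fun _ => (1 : NNReal)) x)
    have e : (t.indicator 1 x : ℂ) =
        (Complex.ofReal ∘ NNReal.toReal) (t.indicator (fun _ => (1 : NNReal)) x) := by
      by_cases hx : x ∈ t <;> simp [hx]
    rw [e]
    exact h'.comp h
  have hconv (g : X → ℂ) (ψ : H) (hg : Integrable g (ν ψ)) :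
      Tendsto (fun n => ∫ x, g x * a n x ∂(ν ψ)) atTop (𝓝 (∫ x in t, g x ∂(ν ψ))) := by
    rw [← integral_indicator ht.measurableSet]
    refine tendsto_integral_of_dominated_convergence (fun x => ‖g x‖)
      (fun n => hg.aestronglyMeasurable.mul (a n).continuous.aestronglyMeasurable) hg.norm
      (fun n => Eventually.of_forall fun x => ?_) (Eventually.of_forall fun x => ?_)
    · rw [norm_mul]
      exact mul_le_of_le_one_right (norm_nonneg _) (ha_norm n x)
    · have := (ha_lim x).const_mul (g x)
      by_cases hx : x ∈ t <;> simpa [hx] using this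
  obtain ⟨T, hT⟩ := exists_tendsto_inner_self (T := fun n => Φ (a n)) fun ψ => by
    have := hconv 1 ψ (by have := (hν ψ).1; exact integrable_const _)
    simpa only [Pi.one_apply, one_mul, ← (hν ψ).2] using this
  have hTlim (ψ : H) : Tendsto (fun n => inner ℂ ψ (Φ (a n) ψ)) atTop (𝓝 (inner ℂ ψ (T ψ))) := by
    rw [hT]
    have := hconv 1 ψ (by have := (hν ψ).1; exact integrable_const _)
    simpa only [Pi.one_apply, one_mul, ← (hν ψ).2] using this
  refine ⟨T, fun g S hS ψ => ?_⟩
  -- Moving `S` to the left factor turns a limit of products into a plain weak limit.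
  have h1 := tendsto_inner_apply_of_tendsto_inner_self hTlim (ContinuousLinearMap.adjoint S ψ) ψ
  simp_rw [ContinuousLinearMap.adjoint_inner_left, (hS ψ).2] at h1
  exact tendsto_nhds_unique h1 (hconv g ψ (hS ψ).1)

variable [CompactSpace X]

/-- The spectral measures of a representation of the algebra of continuous functions. -/
lemma StarAlgHom.exists_measure (Φ : C(X, ℂ) →⋆ₐ[ℂ] (H →L[ℂ] H)) (ψ : H) :
    ∃ ν : Measure X, IsFiniteMeasure ν ∧
      ∀ g : C(X, ℂ), inner ℂ ψ (Φ g ψ) = ∫ x, g x ∂ν := by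
  let Λ₀ : C(X, ℝ) →ₗ[ℝ] ℝ :=
    { toFun := fun g => (inner ℂ ψ (Φ g.toComplex ψ)).re
      map_add' := fun g h => by
        have : (g + h).toComplex = g.toComplex + h.toComplex := by
          ext x; simp [ContinuousMap.toComplex_apply]
        rw [this, map_add, _root_.add_apply, inner_add_right, Complex.add_re]
      map_smul' := fun c g => by
        have : (c • g).toComplex = (c : ℂ) • g.toComplex := by
          ext x; simp [ContinuousMap.toComplex_apply]
        rw [this, map_smul, _root_.smul_apply, inner_smul_right]
        simp }
  have hpos (g : C(X, ℝ)) (hg : ∀ x, 0 ≤ g x) : 0 ≤ Λ₀ g := by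
    -- Positivity: `g = r * r` with `r` real, so the quadratic form of `Φ g` at `ψ` is `‖Φ r ψ‖²`.
    let r : C(X, ℝ) := ⟨fun x => Real.sqrt (g x), by fun_prop⟩
    have hr : g.toComplex = star r.toComplex * r.toComplex := by
      ext x
      simp only [ContinuousMap.toComplex_apply, ContinuousMap.mul_apply, ContinuousMap.star_apply,
        RCLike.star_def, Complex.conj_ofReal, r, ContinuousMap.coe_mk]
      rw [← Complex.ofReal_mul, Real.mul_self_sqrt (hg x)]
    change 0 ≤ (inner ℂ ψ (Φ g.toComplex ψ)).re
    rw [hr, ← Φ.inner_apply_eq]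
    exact inner_self_nonneg (𝕜 := ℂ)
  let Λ : CompactlySupportedContinuousMap X ℝ →ₚ[ℝ] ℝ := PositiveLinearMap.mk₀
    { toFun := fun g => Λ₀ g.toContinuousMap
      map_add' := fun g h => Λ₀.map_add _ _
      map_smul' := fun c g => Λ₀.map_smul _ _ } fun g hg => hpos _ hg
  have hreal (g : C(X, ℝ)) : ∫ x, g x ∂(RealRMK.rieszMeasure Λ) = Λ₀ g :=
    RealRMK.integral_rieszMeasure Λ ⟨g, HasCompactSupport.of_compactSpace _⟩
  have hreal' (g : C(X, ℝ)) :
      inner ℂ ψ (Φ g.toComplex ψ) = ∫ x, g.toComplex x ∂(RealRMK.rieszMeasure Λ) := by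
    simp_rw [ContinuousMap.toComplex_apply]
    rw [integral_complex_ofReal, hreal]
    refine Complex.ext rfl ?_
    rw [Complex.ofReal_im, ← Complex.conj_eq_iff_im, inner_conj_symm,
      ← ContinuousLinearMap.adjoint_inner_right, ← ContinuousLinearMap.star_eq_adjoint, ← map_star]
    congr 3
    ext x
    simp [ContinuousMap.toComplex_apply]
  refine ⟨RealRMK.rieszMeasure Λ, inferInstance, fun g => ?_⟩
  let u : C(X, ℝ) := ⟨fun x => (g x).re, by fun_prop⟩
  let v : C(X, ℝ) := ⟨fun x => (g x).im, by fun_prop⟩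
  have hg : g = u.toComplex + Complex.I • v.toComplex := by
    ext x
    simp only [ContinuousMap.add_apply, ContinuousMap.smul_apply, ContinuousMap.toComplex_apply,
      smul_eq_mul, u, v, ContinuousMap.coe_mk]
    rw [mul_comm, Complex.re_add_im]
  have hint (w : C(X, ℂ)) : Integrable w (RealRMK.rieszMeasure Λ) :=
    w.continuous.integrable_of_hasCompactSupport (HasCompactSupport.of_compactSpace _)
  rw [hg, map_add, map_smul, _root_.add_apply, _root_.smul_apply,
    inner_add_right, inner_smul_right, hreal', hreal']
  simp only [ContinuousMap.add_apply, ContinuousMap.smul_apply, smul_eq_mul]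
  rw [integral_add (hint _) ((hint _).const_mul _), integral_const_mul]

lemma IsSpectralFamily.integrable (hν : IsSpectralFamily Φ ν) (ψ : H) (g : C(X, ℂ)) :
    Integrable g (ν ψ) := by
  have := (hν ψ).1
  exact g.continuous.integrable_of_hasCompactSupport (HasCompactSupport.of_compactSpace _)

lemma IsSpectralFamily.represents (hν : IsSpectralFamily Φ ν) (g : C(X, ℂ)) :
    Represents Φ ν g (Φ g) := by
  refine fun ψ => ⟨hν.integrable ψ g, fun h => ?_⟩
  rw [← mul_apply_eq_comp, ← map_mul, (hν ψ).2]
  rfl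

/-- Borel induction from the closed sets: complements correspond to `1 - T`, and disjoint unions to
weak limits of partial sums. -/
lemma IsSpectralFamily.exists_setOperator (hν : IsSpectralFamily Φ ν) {t : Set X}
    (ht : MeasurableSet t) : ∃ T : H →L[ℂ] H, ∀ g S, Represents Φ ν g S →
      ∀ ψ, inner ℂ ψ (S (T ψ)) = ∫ x in t, g x ∂(ν ψ) := by
  have hcompl (t : Set X) (ht : MeasurableSet t) (h : ∃ T : H →L[ℂ] H, ∀ g S, Represents Φ ν g S →
      ∀ ψ, inner ℂ ψ (S (T ψ)) = ∫ x in t, g x ∂(ν ψ)) :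
      ∃ T : H →L[ℂ] H, ∀ g S, Represents Φ ν g S →
      ∀ ψ, inner ℂ ψ (S (T ψ)) = ∫ x in tᶜ, g x ∂(ν ψ) := by
    obtain ⟨T, hT⟩ := h
    refine ⟨1 - T, fun g S hS ψ => ?_⟩
    rw [_root_.sub_apply, map_sub, inner_sub_right, hT g S hS, one_apply_eq_self,
      hS.inner_self, setIntegral_compl ht (hS ψ).1]
  induction t, ht using MeasurableSet.induction_on_open with
  | isOpen U hU =>
    have := hcompl Uᶜ hU.measurableSet.compl (hν.exists_setOperator_of_isClosed hU.isClosed_compl)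
    rwa [compl_compl] at this
  | compl t ht ih => exact hcompl t ht ih
  | iUnion s hd hs ih =>
    choose T hT using ih
    have hone : Represents Φ ν (1 : C(X, ℂ)) (Φ 1) := hν.represents 1
    have hsum (g : X → ℂ) (S : H →L[ℂ] H) (hS : Represents Φ ν g S) (ψ : H) :
        Tendsto (fun n => inner ℂ ψ (S ((∑ i ∈ Finset.range n, T i) ψ))) atTop
          (𝓝 (∫ x in ⋃ i, s i, g x ∂(ν ψ))) := by
      have := (hasSum_integral_iUnion hs hd (hS ψ).1.integrableOn).tendsto_sum_nat
      simpa only [_root_.sum_apply, map_sum, inner_sum, hT _ g S hS] using this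
    obtain ⟨T', hT'⟩ := exists_tendsto_inner_self
      (T := fun n => ∑ i ∈ Finset.range n, T i)
      (q := fun ψ => ∫ x in ⋃ i, s i, (1 : C(X, ℂ)) x ∂(ν ψ)) fun ψ => by
        simpa only [map_one, one_apply_eq_self] using hsum _ _ hone ψ
    refine ⟨T', fun g S hS ψ => ?_⟩
    have hlim (ψ : H) : Tendsto (fun n => inner ℂ ψ ((∑ i ∈ Finset.range n, T i) ψ)) atTop
        (𝓝 (inner ℂ ψ (T' ψ))) := by
      rw [hT']
      simpa only [map_one, one_apply_eq_self] using hsum _ _ hone ψ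
    have h1 := tendsto_inner_apply_of_tendsto_inner_self hlim (ContinuousLinearMap.adjoint S ψ) ψ
    simp_rw [ContinuousLinearMap.adjoint_inner_left] at h1
    exact tendsto_nhds_unique h1 (hsum g S hS ψ)

end CompactSpectralMeasure

/-! ### Spectral projections and their push-forward to the line. -/

section SetOperator

variable {H : Type*} [NormedAddCommGroup H] [InnerProductSpace ℂ H] [CompleteSpace H]
  {X : Type*} [MetricSpace X] [CompactSpace X] [MeasurableSpace X] [BorelSpace X]
  {Φ : C(X, ℂ) →⋆ₐ[ℂ] (H →L[ℂ] H)} {ν : H → Measure X}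

namespace IsSpectralFamily

/-- The spectral projection of a measurable set. -/
noncomputable def setOperator (hν : IsSpectralFamily Φ ν) {t : Set X} (ht : MeasurableSet t) :
    H →L[ℂ] H :=
  (hν.exists_setOperator ht).choose

variable (hν : IsSpectralFamily Φ ν) {s t : Set X} (hs : MeasurableSet s) (ht : MeasurableSet t)

lemma inner_apply_setOperator {g : X → ℂ} {S : H →L[ℂ] H} (hS : Represents Φ ν g S) (ψ : H) :
    inner ℂ ψ (S (hν.setOperator ht ψ)) = ∫ x in t, g x ∂(ν ψ) :=
  (hν.exists_setOperator ht).choose_spec g S hS ψ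

lemma inner_setOperator (ψ : H) :
    inner ℂ ψ (hν.setOperator ht ψ) = ((ν ψ).real t : ℂ) := by
  have := (hν ψ).1
  have := hν.inner_apply_setOperator ht (hν.represents 1) ψ
  simpa using this

lemma inner_setOperator_comm (φ ψ : H) :
    inner ℂ φ (hν.setOperator ht ψ) = inner ℂ (hν.setOperator ht φ) ψ := by
  rw [← ContinuousLinearMap.adjoint_inner_left]
  congr 2
  refine ContinuousLinearMap.ext_inner_self fun ψ => ?_
  rw [ContinuousLinearMap.adjoint_inner_right, ← inner_conj_symm, inner_setOperator,
    Complex.conj_ofReal]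

/-- Set operators thereby qualify as test operators `S` in `inner_apply_setOperator`, which makes
them multiplicative and hence projections. -/
lemma represents_setOperator : Represents Φ ν (t.indicator 1) (hν.setOperator ht) := by
  intro ψ
  have := (hν ψ).1
  refine ⟨(integrable_const (1 : ℂ)).indicator ht, fun h => ?_⟩
  have h1 := hν.inner_apply_setOperator ht (hν.represents (star h)) ψ
  rw [hν.inner_setOperator_comm, ← inner_conj_symm, ← ContinuousLinearMap.adjoint_inner_right,
    ← ContinuousLinearMap.star_eq_adjoint, ← map_star, h1, ← integral_conj,
    ← integral_indicator ht]
  congr 1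
  ext x
  by_cases hx : x ∈ t <;> simp [hx]

lemma setOperator_mul : hν.setOperator hs * hν.setOperator ht = hν.setOperator (hs.inter ht) := by
  refine ContinuousLinearMap.ext_inner_self fun ψ => ?_
  have := (hν ψ).1
  rw [mul_apply_eq_comp, hν.inner_apply_setOperator ht (hν.represents_setOperator hs),
    inner_setOperator, integral_indicator hs, Measure.restrict_restrict hs]
  simp

lemma norm_setOperator_sq (ψ : H) : ‖hν.setOperator ht ψ‖ ^ 2 = (ν ψ).real t := by
  have h : inner ℂ (hν.setOperator ht ψ) (hν.setOperator ht ψ) = ((ν ψ).real t : ℂ) := by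
    rw [← hν.inner_setOperator_comm, ← mul_apply_eq_comp, hν.setOperator_mul ht ht,
      inner_setOperator, inter_self]
  rw [inner_self_eq_norm_sq_to_K] at h
  exact Complex.ofReal_injective (by push_cast; exact h)

lemma isStarProjection_setOperator : IsStarProjection (hν.setOperator ht) where
  isIdempotentElem := by
    rw [IsIdempotentElem, setOperator_mul]
    simp only [inter_self]
  isSelfAdjoint := by
    rw [ContinuousLinearMap.isSelfAdjoint_iff_isSymmetric]
    exact fun φ ψ => (hν.inner_setOperator_comm ht φ ψ).symm

open scoped Classical in
/-- The push-forward of the spectral projections under a measurable real-valued function. -/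
noncomputable def projectionValuedMeasure {κ : X → ℝ} (hκ : Measurable κ) :
    ProjectionValuedMeasure H where
  proj s := if hs : MeasurableSet s then hν.setOperator (hκ hs) else 0
  isStarProjection s hs := by
    rw [dif_pos hs]
    exact hν.isStarProjection_setOperator _
  proj_univ := by
    rw [dif_pos .univ]
    refine ContinuousLinearMap.ext_inner_self fun ψ => ?_
    have := (hν ψ).2 1
    rw [inner_setOperator]
    simp only [map_one, one_apply_eq_self] at this ⊢
    rw [this]
    simp
  proj_inter s t hs ht := by
    rw [dif_pos hs, dif_pos ht, dif_pos (hs.inter ht), setOperator_mul]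
    rfl
  hasSum_iUnion s hs hd ψ := by
    simp only [hs, MeasurableSet.iUnion hs, dif_pos]
    have := (hν ψ).1
    have hU := MeasurableSet.iUnion hs
    rw [HasSum, SummationFilter.unconditional_filter, tendsto_iff_norm_sub_tendsto_zero]
    -- The error of a partial sum is itself a spectral projection, so its squared norm is the
    -- measure of the remaining set; strong convergence thus reduces to countable additivity of `ν
    -- ψ`.
    have hnorm (F : Finset ℕ) : ‖∑ i ∈ F, hν.setOperator (hκ (hs i)) ψ -
        hν.setOperator (hκ hU) ψ‖ ^ 2 =
        (ν ψ).real (κ ⁻¹' ⋃ i, s i) - ∑ i ∈ F, (ν ψ).real (κ ⁻¹' s i) := by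
      have hF : MeasurableSet (⋃ i ∈ F, κ ⁻¹' s i) := F.measurableSet_biUnion fun i _ => hκ (hs i)
      have hdF : (F : Set ℕ).PairwiseDisjoint fun i => κ ⁻¹' s i :=
        fun i _ j _ hij => (hd hij).preimage κ
      have hsub : (⋃ i ∈ F, κ ⁻¹' s i) ⊆ κ ⁻¹' ⋃ i, s i := by
        simp only [preimage_iUnion]
        exact iUnion₂_subset fun i _ => subset_iUnion (fun i => κ ⁻¹' s i) i
      have hsumF (χ : H) : (ν χ).real (⋃ i ∈ F, κ ⁻¹' s i) =
          ∑ i ∈ F, (ν χ).real (κ ⁻¹' s i) := by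
        have := (hν χ).1
        exact measureReal_biUnion_finset hdF fun i _ => hκ (hs i)
      have hdiff : hν.setOperator (hκ hU) - ∑ i ∈ F, hν.setOperator (hκ (hs i)) =
          hν.setOperator ((hκ hU).diff hF) := by
        refine ContinuousLinearMap.ext_inner_self fun χ => ?_
        have := (hν χ).1
        rw [_root_.sub_apply, inner_sub_right, _root_.sum_apply, inner_sum]
        simp only [inner_setOperator]
        rw [measureReal_sdiff hsub hF, hsumF]
        push_cast
        rfl
      rw [← norm_neg, neg_sub, ← _root_.sum_apply, ← _root_.sub_apply, hdiff,
        norm_setOperator_sq, measureReal_sdiff hsub hF, hsumF]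
    have hsum : HasSum (fun i => (ν ψ).real (κ ⁻¹' s i)) ((ν ψ).real (κ ⁻¹' ⋃ i, s i)) := by
      rw [preimage_iUnion]
      have hm : ν ψ (⋃ i, κ ⁻¹' s i) = ∑' i, ν ψ (κ ⁻¹' s i) :=
        measure_iUnion (fun i j hij => (hd hij).preimage κ) fun i => hκ (hs i)
      have := ENNReal.hasSum_toReal (hm ▸ measure_ne_top (ν ψ) _)
      rwa [← ENNReal.tsum_toReal_eq fun i => measure_ne_top _ _, ← hm] at this
    have hlim : Tendsto (fun F : Finset ℕ => ‖∑ i ∈ F, hν.setOperator (hκ (hs i)) ψ -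
        hν.setOperator (hκ hU) ψ‖ ^ 2) atTop (𝓝 0) := by
      simp_rw [hnorm]
      have := hsum.const_sub ((ν ψ).real (κ ⁻¹' ⋃ i, s i))
      rwa [sub_self] at this
    have := hlim.sqrt
    simpa using this

lemma measure_projectionValuedMeasure {κ : X → ℝ} (hκ : Measurable κ) (ψ : H) :
    (hν.projectionValuedMeasure hκ).measure ψ = (ν ψ).map κ := by
  have := (hν ψ).1
  ext s hs
  rw [ProjectionValuedMeasure.measure_apply _ _ hs, Measure.map_apply hκ hs]
  simp only [projectionValuedMeasure, dif_pos hs, inner_setOperator, Complex.ofReal_re]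
  exact ofReal_measureReal

/-- `⟨Φ g ψ, Φ f Φ g ψ⟩ = ⟨ψ, Φ (|g|² f) ψ⟩`, and a finite measure is determined by its integrals of
bounded continuous functions. -/
lemma measure_apply_eq_withDensity (hν : IsSpectralFamily Φ ν) (g : C(X, ℂ)) (ψ : H) :
    ν (Φ g ψ) = (ν ψ).withDensity fun x => ‖g x‖ₑ ^ 2 := by
  have := (hν ψ).1
  have := (hν (Φ g ψ)).1
  have hden : (fun x => ‖g x‖ₑ ^ 2) = fun x => ((‖g x‖₊ ^ 2 : NNReal) : ENNReal) := by
    ext x; simp [enorm_eq_nnnorm]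
  have hmeas : Measurable fun x => ‖g x‖₊ ^ 2 := by fun_prop
  have : IsFiniteMeasure ((ν ψ).withDensity fun x => ‖g x‖ₑ ^ 2) := by
    refine isFiniteMeasure_withDensity ?_
    have h2 := (hν.integrable ψ (star g * g)).2
    rw [HasFiniteIntegral] at h2
    refine ne_of_lt (lt_of_eq_of_lt ?_ h2)
    congr 1; ext x; simp [pow_two]
  refine ext_of_forall_integral_eq_of_IsFiniteMeasure fun f => ?_
  have h1 := (hν (Φ g ψ)).2 f.toContinuousMap.toComplex
  rw [← mul_apply_eq_comp, ← map_mul, Φ.inner_apply_eq, (hν ψ).2] at h1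
  rw [hden, integral_withDensity_eq_integral_smul hmeas, ← Complex.ofReal_inj,
    ← integral_complex_ofReal, ← integral_complex_ofReal]
  have h2 (x : X) : ((f x : ℝ) : ℂ) = f.toContinuousMap.toComplex x := rfl
  simp_rw [h2]
  rw [← h1]
  congr 1
  ext x
  simp only [ContinuousMap.mul_apply, ContinuousMap.star_apply, RCLike.star_def, NNReal.smul_def,
    smul_eq_mul, NNReal.coe_pow, coe_nnnorm, Complex.ofReal_mul, ← h2, Complex.ofReal_pow]
  linear_combination ((f x : ℝ) : ℂ) * Complex.conj_mul' (g x)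

end IsSpectralFamily

end SetOperator

/-! ### The spectral theorem for unbounded self-adjoint operators. -/

section SpectralTheorem

variable {H : Type*} [NormedAddCommGroup H] [InnerProductSpace ℂ H] [CompleteSpace H]

/-- The representation of `λ ∈ ℝ` by `w = (λ + i)⁻¹`, inverted: `λ = re w / |w|²`. -/
noncomputable def realOfResolvent (w : ℂ) : ℝ := w.re / Complex.normSq w

lemma measurable_realOfResolvent : Measurable realOfResolvent := by
  unfold realOfResolvent
  exact Complex.measurable_re.div Complex.continuous_normSq.measurable

lemma realOfResolvent_mul_normSq (w : ℂ) : realOfResolvent w * Complex.normSq w = w.re := by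
  rcases eq_or_ne w 0 with rfl | hw
  · simp [realOfResolvent]
  · exact div_mul_cancel₀ _ (Complex.normSq_pos.2 hw).ne'

/-- The condition `h` is the equation of the circle traced by `w = (λ + i)⁻¹`, completed by `w = 0`
for `λ = ∞`; on it `|w|⁻² = λ² + 1`. -/
lemma inv_normSq_eq {w : ℂ} (hw : w ≠ 0) (h : w.im = -Complex.normSq w) :
    (Complex.normSq w)⁻¹ = realOfResolvent w ^ 2 + 1 := by
  have h0 := (Complex.normSq_pos.2 hw).ne'
  have h1 : Complex.normSq w = w.re * w.re + w.im * w.im := Complex.normSq_apply w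
  rw [h] at h1
  rw [realOfResolvent]
  field_simp
  linarith

/-- The operator `R = (K + i)⁻¹` is bounded and normal, with spectrum on the circle of the points
`(λ + i)⁻¹`. Its spectral projections, pushed to the line by `w ↦ λ`, form the spectral measure of
`K`; the domain of `K` is the range of `R`. -/
theorem IsSelfAdjoint.exists_isSpectralMeasureOf {K : H →ₗ.[ℂ] H} (hK : IsSelfAdjoint K) :
    ∃ E : ProjectionValuedMeasure H, E.IsSpectralMeasureOf K := by
  have hI : (-Complex.I).im ≠ 0 := by simp
  have hI' : Complex.I.im ≠ 0 := by simp
  let R := resolventOp K (-Complex.I)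
  have hR : IsResolventAt K (-Complex.I) R := hK.isResolventAt hI
  have hstar : star R = resolventOp K Complex.I := by
    rw [ContinuousLinearMap.star_eq_adjoint, hK.adjoint_resolventOp hI]; simp
  have hR' : IsResolventAt K Complex.I (star R) := hstar ▸ hK.isResolventAt hI'
  -- The resolvent identity at `i` and `-i`, in both orders: comparing the right-hand sides gives
  -- normality.
  have h1 : star R - R = (2 * Complex.I) • (star R * R) := by
    rw [hR'.sub_eq hR]; congr 1; ring
  have h2 : star R - R = (2 * Complex.I) • (R * star R) := by
    rw [← neg_sub, hR.sub_eq hR', ← neg_smul]; congr 1; ring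
  have hnormal : IsStarNormal R := ⟨by
    have := h1.symm.trans h2
    exact smul_right_injective _ (by simp : (2 * Complex.I) ≠ 0) this⟩
  let Φ : C(spectrum ℂ R, ℂ) →⋆ₐ[ℂ] (H →L[ℂ] H) := cfcHom hnormal
  let ι : C(spectrum ℂ R, ℂ) := ContinuousMap.restrict (spectrum ℂ R) (ContinuousMap.id ℂ)
  have hι : Φ ι = R := cfcHom_id hnormal
  have hι_apply (x : spectrum ℂ R) : ι x = x := rfl
  -- The operator identity `h1` pulls back to the coordinate function because the functional
  -- calculus is injective.
  have him (x : spectrum ℂ R) : (x : ℂ).im = -Complex.normSq x := by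
    have h : star ι - ι = (2 * Complex.I) • (star ι * ι) := by
      apply cfcHom_injective hnormal
      change Φ _ = Φ _
      rw [map_sub, map_smul, map_mul, map_star, hι, h1]
    have := congrArg Complex.im (DFunLike.congr_fun h x)
    simp [hι_apply] at this
    simp [Complex.normSq_apply]
    linarith
  choose ν hνf hν' using Φ.exists_measure
  have hν : IsSpectralFamily Φ ν := fun ψ => ⟨hνf ψ, hν' ψ⟩
  have hκ : Measurable fun x : spectrum ℂ R => realOfResolvent x :=
    measurable_realOfResolvent.comp measurable_subtype_coe
  have hden (η : H) : ν (R η) = (ν η).withDensity fun x => ‖(x : ℂ)‖ₑ ^ 2 := by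
    have := hν.measure_apply_eq_withDensity ι η
    rwa [hι] at this
  have hden' : (fun x : spectrum ℂ R => ‖(x : ℂ)‖ₑ ^ 2) =
      fun x : spectrum ℂ R => ((‖(x : ℂ)‖₊ ^ 2 : NNReal) : ENNReal) := by
    ext x; simp [enorm_eq_nnnorm]
  have hdmeas : Measurable fun x : spectrum ℂ R => ‖(x : ℂ)‖₊ ^ 2 := by fun_prop
  have hsq (x : spectrum ℂ R) : ((‖(x : ℂ)‖₊ ^ 2 : NNReal) : ℝ) = Complex.normSq x := by
    rw [Complex.normSq_eq_norm_sq]; simp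
  have hrange (ψ : H) (hψ : ψ ∈ K.domain) :
      ∃ η, R η = ψ ∧ K ⟨ψ, hψ⟩ = η - Complex.I • R η := by
    refine ⟨_, hR.2 ⟨ψ, hψ⟩, ?_⟩
    rw [hR.2 ⟨ψ, hψ⟩]; simp
  have hS0 : MeasurableSet {x : spectrum ℂ R | (x : ℂ) = 0} :=
    measurableSet_eq_fun (by fun_prop) measurable_const
  -- No mass sits at `λ = ∞`: the measure of `R η` has density `|w|²`, so the projection of `{0}`
  -- kills the range of `R`, which is dense.
  have hzero (ψ : H) : ν ψ {x : spectrum ℂ R | (x : ℂ) = 0} = 0 := by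
    have hop : hν.setOperator hS0 = 0 := by
      have h0 : ∀ ψ ∈ K.domain, hν.setOperator hS0 ψ = 0 := by
        intro ψ hψ
        obtain ⟨η, rfl, -⟩ := hrange ψ hψ
        have h3 := hν.norm_setOperator_sq hS0 (R η)
        have h4 : ν (R η) {x : spectrum ℂ R | (x : ℂ) = 0} = 0 := by
          rw [hden, withDensity_apply _ hS0]
          exact (setLIntegral_congr_fun hS0 fun x hx => by
            simp [show (x : ℂ) = 0 from hx]).trans (lintegral_zero)
        rw [measureReal_def, h4, ENNReal.toReal_zero, sq_eq_zero_iff, norm_eq_zero] at h3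
        exact h3
      ext ψ
      exact DFunLike.congr_fun (DFunLike.coe_injective.eq_iff.1 (Continuous.ext_on hK.dense_domain
        (hν.setOperator hS0).continuous (0 : H →L[ℂ] H).continuous h0)) ψ
    have h3 := hν.norm_setOperator_sq hS0 ψ
    have := hνf ψ
    rw [hop] at h3
    simpa [measureReal_eq_zero_iff] using h3.symm
  refine ⟨hν.projectionValuedMeasure hκ, fun ψ => ⟨fun hψ => ?_, fun hψ => ?_⟩, fun ψ => ?_⟩
  · obtain ⟨η, rfl, -⟩ := hrange ψ hψ
    have := hνf η
    rw [hν.measure_projectionValuedMeasure hκ,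
      integrable_map_measure (by fun_prop) hκ.aemeasurable, hden, hden',
      integrable_withDensity_iff_integrable_smul hdmeas]
    refine Integrable.of_bound (C := 1) ?_ (Eventually.of_forall fun x => ?_)
    · exact (hdmeas.smul (hκ.pow_const 2)).aestronglyMeasurable
    · rw [NNReal.smul_def, hsq, smul_eq_mul, Function.comp, Real.norm_of_nonneg
        (mul_nonneg (Complex.normSq_nonneg _) (sq_nonneg _))]
      rcases eq_or_ne (x : ℂ) 0 with hx | hx
      · simp [hx]
      · have h3 := inv_normSq_eq hx (him x)
        have h4 := Complex.normSq_pos.2 hx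
        rw [mul_comm, ← le_div_iff₀ h4, one_div, h3]
        linarith
  · rw [hν.measure_projectionValuedMeasure hκ,
      integrable_map_measure (by fun_prop) hκ.aemeasurable] at hψ
    have := hνf ψ
    have hpos (n : ℕ) (x : spectrum ℂ R) :
        0 < max (Complex.normSq x) (1 / ((n : ℝ) + 1)) :=
      lt_max_of_lt_right (by positivity)
    -- `g n` is a continuous truncation of the inverse of `conj w`, which is `w / |w|²`. Its square
    -- is dominated by `λ² + 1`, and `conj w * g n` tends to `1` off `w = 0`.
    let g (n : ℕ) : C(spectrum ℂ R, ℂ) :=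
      ⟨fun x => (x : ℂ) / (max (Complex.normSq x) (1 / ((n : ℝ) + 1)) : ℝ), by
        refine Continuous.div (by fun_prop) ?_ fun x => by exact_mod_cast (hpos n x).ne'
        exact Complex.continuous_ofReal.comp
          ((Complex.continuous_normSq.comp continuous_subtype_val).max continuous_const)⟩
    have hg (n : ℕ) (x : spectrum ℂ R) : g n x =
      (x : ℂ) / (max (Complex.normSq x) (1 / ((n : ℝ) + 1)) : ℝ) := rfl
    have hint : Integrable (fun x : spectrum ℂ R => realOfResolvent x ^ 2 + 1) (ν ψ) :=
      hψ.add (integrable_const 1)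
    have hnorm (h : C(spectrum ℂ R, ℂ)) (χ : H) : ‖Φ h χ‖ ^ 2 = ∫ x, ‖h x‖ ^ 2 ∂(ν χ) := by
      have h3 : inner ℂ (Φ h χ) (Φ h χ) = ((∫ x, ‖h x‖ ^ 2 ∂(ν χ) : ℝ) : ℂ) := by
        rw [Φ.inner_apply_eq, hν', ← integral_complex_ofReal]
        congr 1; ext x
        simp [Complex.conj_mul']
      rw [inner_self_eq_norm_sq_to_K] at h3
      exact Complex.ofReal_injective (by push_cast; exact h3)
    set C := ∫ x : spectrum ℂ R, (realOfResolvent x ^ 2 + 1) ∂(ν ψ) with hC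
    have hC0 : 0 ≤ C := integral_nonneg fun x => by positivity
    have hbound (n : ℕ) : ‖Φ (g n) ψ‖ ≤ Real.sqrt C := by
      refine Real.le_sqrt_of_sq_le ?_
      rw [hnorm]
      refine integral_mono_of_nonneg (Eventually.of_forall fun x => sq_nonneg _) hint
        (Eventually.of_forall fun x => ?_)
      change ‖g n x‖ ^ 2 ≤ realOfResolvent x ^ 2 + 1
      rcases eq_or_ne (x : ℂ) 0 with hx | hx
      · rw [hg, hx]; simp; positivity
      · have h4 := Complex.normSq_pos.2 hx
        rw [← inv_normSq_eq hx (him x), hg, norm_div, Complex.norm_real,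
          Real.norm_of_nonneg (hpos n x).le, div_pow, ← Complex.normSq_eq_norm_sq,
          div_le_iff₀ (pow_pos (hpos n x) 2), inv_mul_eq_div, le_div_iff₀ h4, ← pow_two]
        gcongr
        exact le_max_left _ _
    have hlim : Tendsto (fun n => Φ (star ι * g n) ψ) atTop (𝓝 ψ) := by
      rw [tendsto_iff_norm_sub_tendsto_zero]
      have h5 (n : ℕ) : ‖Φ (star ι * g n) ψ - ψ‖ ^ 2 =
          ∫ x, ‖(star ι * g n - 1 : C(spectrum ℂ R, ℂ)) x‖ ^ 2 ∂(ν ψ) := by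
        rw [← hnorm, map_sub, map_one, _root_.sub_apply, one_apply_eq_self]
      have hval (n : ℕ) (x : spectrum ℂ R) : (star ι * g n - 1 : C(spectrum ℂ R, ℂ)) x =
          ((Complex.normSq x / max (Complex.normSq x) (1 / ((n : ℝ) + 1)) - 1 : ℝ) : ℂ) := by
        simp only [ContinuousMap.sub_apply, ContinuousMap.mul_apply, ContinuousMap.star_apply,
          hι_apply, hg, ContinuousMap.one_apply, RCLike.star_def]
        rw [← mul_div_assoc, ← Complex.normSq_eq_conj_mul_self]
        push_cast
        rfl
      have h6 : Tendsto (fun n => ∫ x, ‖(star ι * g n - 1 : C(spectrum ℂ R, ℂ)) x‖ ^ 2 ∂(ν ψ))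
          atTop (𝓝 (∫ _, (0 : ℝ) ∂(ν ψ))) := by
        refine tendsto_integral_of_dominated_convergence (fun _ => 1)
          (fun n => (by fun_prop : Continuous _).aestronglyMeasurable) (integrable_const _)
          (fun n => Eventually.of_forall fun x => ?_) ?_
        · rw [hval, Complex.norm_real, Real.norm_of_nonneg (sq_nonneg _), Real.norm_eq_abs, sq_abs]
          have h7 : Complex.normSq x / max (Complex.normSq x) (1 / ((n : ℝ) + 1)) ≤ 1 :=
            div_le_one_of_le₀ (le_max_left _ _) (hpos n x).le
          have h8 : 0 ≤ Complex.normSq x / max (Complex.normSq x) (1 / ((n : ℝ) + 1)) :=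
            div_nonneg (Complex.normSq_nonneg _) (hpos n x).le
          nlinarith
        · have h9 : ∀ᵐ x : spectrum ℂ R ∂(ν ψ), (x : ℂ) ≠ 0 := by
            rw [ae_iff]; simpa using hzero ψ
          filter_upwards [h9] with x hx
          have h4 := Complex.normSq_pos.2 hx
          refine tendsto_const_nhds.congr' ?_
          have h10 : ∀ᶠ n : ℕ in atTop, 1 / ((n : ℝ) + 1) < Complex.normSq x :=
            (tendsto_one_div_add_atTop_nhds_zero_nat).eventually (gt_mem_nhds h4)
          filter_upwards [h10] with n hn
          rw [hval, max_eq_left hn.le, div_self h4.ne']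
          simp
      simp_rw [← h5] at h6
      simpa using h6.sqrt
    -- By self-adjointness it suffices to bound `φ ↦ ⟨ψ, Kφ⟩`. With `φ = R η` and `Kφ = η - i R η`,
    -- the term `⟨ψ, η⟩` is the limit of `⟨Φ (g n) ψ, R η⟩`.
    rw [← LinearPMap.isSelfAdjoint_def.1 hK, LinearPMap.mem_adjoint_domain_iff]
    refine AddMonoidHomClass.continuous_of_bound
      ((innerₛₗ ℂ ψ).comp K.toFun) (Real.sqrt C + ‖ψ‖) fun φ => ?_
    obtain ⟨η, h3, h4⟩ := hrange φ φ.2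
    have h11 : ‖inner ℂ ψ η‖ ≤ Real.sqrt C * ‖R η‖ := by
      have h12 : Tendsto (fun n => ‖inner ℂ (Φ (star ι * g n) ψ) η‖) atTop
          (𝓝 ‖inner ℂ ψ η‖) := (hlim.inner tendsto_const_nhds).norm
      refine le_of_tendsto h12 (Eventually.of_forall fun n => ?_)
      rw [map_mul, map_star, hι, mul_apply_eq_comp, ContinuousLinearMap.star_eq_adjoint,
        ContinuousLinearMap.adjoint_inner_left]
      exact (norm_inner_le_norm _ _).trans (by gcongr; exact hbound n)
    have h13 : ((innerₛₗ ℂ ψ).comp K.toFun) φ = inner ℂ ψ η - Complex.I * inner ℂ ψ (R η) := by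
      change inner ℂ ψ (K ⟨φ, φ.2⟩) = _
      rw [h4, inner_sub_right, inner_smul_right]
    have h14 : ‖φ‖ = ‖R η‖ := by rw [h3]; rfl
    rw [h13, h14, add_mul]
    refine (norm_sub_le _ _).trans (add_le_add h11 ?_)
    rw [norm_mul, Complex.norm_I, one_mul]
    exact norm_inner_le_norm _ _
  · obtain ⟨η, h3, h4⟩ := hrange ψ ψ.2
    have := hνf η
    rw [hν.measure_projectionValuedMeasure hκ,
      integral_map hκ.aemeasurable (by fun_prop), ← h3, hden, hden',
      integral_withDensity_eq_integral_smul hdmeas]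
    have h5 : inner ℂ (ψ : H) (K ψ) = inner ℂ η (Φ (star ι * (1 - Complex.I • ι)) η) := by
      rw [← Φ.inner_apply_eq, hι, map_sub, map_one, map_smul, hι, h3]
      change inner ℂ (ψ : H) (K ⟨ψ, ψ.2⟩) = _
      rw [h4, h3]
      simp [h3]
    rw [h3, h5, hν']
    congr 1
    ext x
    -- On the circle, the symbol of `⟨R η, K R η⟩` is real and equals `re w = λ |w|²`.
    have hx : ((x : ℂ).re : ℂ) = star (x : ℂ) * (1 - Complex.I * x) := by
      apply Complex.ext
      · have := him x
        rw [Complex.normSq_apply] at this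
        simp
        nlinarith
      · have := him x
        rw [Complex.normSq_apply] at this
        simp
        nlinarith
    rw [NNReal.smul_def, hsq, Complex.real_smul, ← Complex.ofReal_mul, mul_comm (Complex.normSq _),
      realOfResolvent_mul_normSq, hx]
    rfl

end SpectralTheorem

/-! ### Integration of bounded functions against a projection-valued measure. -/

section Calculus

variable {H : Type*} [NormedAddCommGroup H] [InnerProductSpace ℂ H] [CompleteSpace H]

namespace ProjectionValuedMeasure

variable (E : ProjectionValuedMeasure H)

lemma inner_proj {s : Set ℝ} (hs : MeasurableSet s) (ψ : H) :
    inner ℂ ψ (E.proj s ψ) = ((E.measure ψ).real s : ℂ) := by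
  rw [measureReal_def, E.measure_apply ψ hs, ENNReal.toReal_ofReal (E.re_inner_nonneg hs ψ)]
  have h := (E.isStarProjection s hs).isSelfAdjoint
  rw [ContinuousLinearMap.isSelfAdjoint_iff_isSymmetric] at h
  refine (Complex.conj_eq_iff_re.1 ?_).symm
  rw [inner_conj_symm]
  exact h ψ ψ

instance (ψ : H) : IsFiniteMeasure (E.measure ψ) :=
  ⟨by rw [E.measure_apply ψ .univ]; exact ENNReal.ofReal_lt_top⟩

lemma measureReal_univ (ψ : H) : (E.measure ψ).real univ = ‖ψ‖ ^ 2 := by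
  have h := E.inner_proj .univ ψ
  rw [E.proj_univ, one_apply_eq_self, inner_self_eq_norm_sq_to_K] at h
  exact (Complex.ofReal_injective (by push_cast; exact h)).symm

/-- `T` is the integral `∫ g dE`. -/
def IsIntegral (g : ℝ → ℂ) (T : H →L[ℂ] H) : Prop :=
  ∀ ψ, Integrable g (E.measure ψ) ∧ inner ℂ ψ (T ψ) = ∫ l, g l ∂(E.measure ψ)

/-- The operator `T` represents the multiplication by `g` on indicator functions. -/
def Multiplies (g : ℝ → ℂ) (T : H →L[ℂ] H) : Prop :=
  ∀ ψ, Integrable g (E.measure ψ) ∧ ∀ s, MeasurableSet s →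
    inner ℂ ψ (T (E.proj s ψ)) = ∫ l in s, g l ∂(E.measure ψ)

variable {E}

lemma IsIntegral.unique {g : ℝ → ℂ} {S T : H →L[ℂ] H} (hS : E.IsIntegral g S)
    (hT : E.IsIntegral g T) : S = T :=
  ContinuousLinearMap.ext_inner_self fun ψ => (hS ψ).2.trans (hT ψ).2.symm

lemma IsIntegral.integral_eq {g : ℝ → ℂ} {T : H →L[ℂ] H} (hT : E.IsIntegral g T) :
    E.integral g = T := by
  have h : ∃ T : H →L[ℂ] H, ∀ ψ : H,
      Integrable g (E.measure ψ) ∧ inner ℂ ψ (T ψ) = ∫ l, g l ∂(E.measure ψ) := ⟨T, hT⟩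
  rw [ProjectionValuedMeasure.integral, dif_pos h]
  exact IsIntegral.unique (E := E) h.choose_spec hT

lemma IsIntegral.star {g : ℝ → ℂ} {T : H →L[ℂ] H} (hT : E.IsIntegral g T) :
    E.IsIntegral (star g) (star T) := by
  refine fun ψ => ⟨?_, ?_⟩
  · have := (hT ψ).1
    exact Complex.conjCLE.integrable_comp_iff.2 this
  · rw [ContinuousLinearMap.star_eq_adjoint, ContinuousLinearMap.adjoint_inner_right,
      ← inner_conj_symm, (hT ψ).2, ← integral_conj]
    rfl

lemma IsIntegral.sub {g h : ℝ → ℂ} {S T : H →L[ℂ] H} (hS : E.IsIntegral g S)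
    (hT : E.IsIntegral h T) : E.IsIntegral (g - h) (S - T) := by
  refine fun ψ => ⟨(hS ψ).1.sub (hT ψ).1, ?_⟩
  rw [_root_.sub_apply, inner_sub_right, (hS ψ).2, (hT ψ).2]
  exact (integral_sub (hS ψ).1 (hT ψ).1).symm

lemma multiplies_one : E.Multiplies 1 1 := by
  refine fun ψ => ⟨integrable_const _, fun s hs => ?_⟩
  rw [one_apply_eq_self, E.inner_proj hs]
  simp

lemma multiplies_proj {t : Set ℝ} (ht : MeasurableSet t) :
    E.Multiplies (t.indicator 1) (E.proj t) := by
  refine fun ψ => ⟨(integrable_const (1 : ℂ)).indicator ht, fun s hs => ?_⟩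
  rw [← mul_apply_eq_comp, ← E.proj_inter t s ht hs, E.inner_proj (ht.inter hs),
    integral_indicator ht, Measure.restrict_restrict ht]
  simp

/-- The defining property of the integral `∫ g dE`, in a form that determines its products with
other operators. -/
def HasIntegral (E : ProjectionValuedMeasure H) (g : ℝ → ℂ) (T : H →L[ℂ] H) : Prop :=
  ∀ f S, E.Multiplies f S → ∀ ψ, inner ℂ ψ (S (T ψ)) = ∫ l, f l * g l ∂(E.measure ψ)

lemma exists_hasIntegral_simpleFunc (g : SimpleFunc ℝ ℂ) : ∃ T, E.HasIntegral g T := by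
  induction g using SimpleFunc.induction with
  | const c hs =>
    rename_i s
    refine ⟨c • E.proj s, fun f S hS ψ => ?_⟩
    rw [_root_.smul_apply, map_smul, inner_smul_right, (hS ψ).2 s hs,
      ← integral_const_mul, ← integral_indicator hs]
    congr 1
    ext l
    by_cases hl : l ∈ s <;> simp [hl, mul_comm]
  | @add g h hd hg hh =>
    obtain ⟨T, hT⟩ := hg
    obtain ⟨T', hT'⟩ := hh
    refine ⟨T + T', fun f S hS ψ => ?_⟩
    have hint (g : SimpleFunc ℝ ℂ) : Integrable (fun l => f l * g l) (E.measure ψ) := by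
      obtain ⟨C, hC⟩ := g.exists_forall_norm_le
      exact (hS ψ).1.mul_bdd g.aestronglyMeasurable (Eventually.of_forall hC)
    rw [_root_.add_apply, map_add, inner_add_right, hT f S hS, hT' f S hS,
      ← integral_add (hint g) (hint h)]
    simp only [SimpleFunc.coe_add, Pi.add_apply, mul_add]

/-- Weak limit of the integrals of uniformly bounded simple functions; the test operators pass
through the limit as adjoints. -/
lemma exists_hasIntegral {g : ℝ → ℂ} (hg : Measurable g) {C : ℝ} (hC : ∀ l, ‖g l‖ ≤ C) :
    ∃ T, E.HasIntegral g T := by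
  have hgs := hg.stronglyMeasurable
  have hC0 : 0 ≤ C := (norm_nonneg _).trans (hC 0)
  choose T hT using fun n => exists_hasIntegral_simpleFunc (E := E) (hgs.approxBounded C n)
  have hconv (f : ℝ → ℂ) (ψ : H) (hf : Integrable f (E.measure ψ)) :
      Tendsto (fun n => ∫ l, f l * hgs.approxBounded C n l ∂(E.measure ψ)) atTop
        (𝓝 (∫ l, f l * g l ∂(E.measure ψ))) := by
    refine tendsto_integral_of_dominated_convergence (fun l => ‖f l‖ * C)
      (fun n => hf.aestronglyMeasurable.mul (SimpleFunc.aestronglyMeasurable _))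
      (hf.norm.mul_const C)
      (fun n => Eventually.of_forall fun l => ?_) (Eventually.of_forall fun l => ?_)
    · rw [norm_mul]
      gcongr
      exact hgs.norm_approxBounded_le hC0 n l
    · exact (hgs.tendsto_approxBounded_of_norm_le (hC l)).const_mul (f l)
  have hone (ψ : H) : Tendsto (fun n => inner ℂ ψ (T n ψ)) atTop
      (𝓝 (∫ l, (1 : ℝ → ℂ) l * g l ∂(E.measure ψ))) := by
    have := hconv 1 ψ (integrable_const _)
    simp_rw [← hT _ 1 1 multiplies_one ψ] at this
    exact this
  obtain ⟨S, hS⟩ := exists_tendsto_inner_self hone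
  simp_rw [← hS] at hone
  refine ⟨S, fun f U hU ψ => ?_⟩
  have h1 := tendsto_inner_apply_of_tendsto_inner_self hone (ContinuousLinearMap.adjoint U ψ) ψ
  simp_rw [ContinuousLinearMap.adjoint_inner_left, hT _ f U hU ψ] at h1
  exact tendsto_nhds_unique h1 (hconv f ψ (hU ψ).1)

lemma HasIntegral.isIntegral {g : ℝ → ℂ} {T : H →L[ℂ] H} (hT : E.HasIntegral g T)
    (hg : Measurable g) {C : ℝ} (hC : ∀ l, ‖g l‖ ≤ C) : E.IsIntegral g T := by
  refine fun ψ => ⟨Integrable.of_bound hg.aestronglyMeasurable C (Eventually.of_forall hC), ?_⟩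
  simpa using hT 1 1 multiplies_one ψ

lemma exists_isIntegral {g : ℝ → ℂ} (hg : Measurable g) {C : ℝ} (hC : ∀ l, ‖g l‖ ≤ C) :
    ∃ T, E.IsIntegral g T := by
  obtain ⟨T, hT⟩ := exists_hasIntegral (E := E) hg hC
  exact ⟨T, hT.isIntegral hg hC⟩

lemma IsIntegral.hasIntegral {g : ℝ → ℂ} {T : H →L[ℂ] H} (hT : E.IsIntegral g T)
    (hg : Measurable g) {C : ℝ} (hC : ∀ l, ‖g l‖ ≤ C) : E.HasIntegral g T := by
  obtain ⟨S, hS⟩ := exists_hasIntegral (E := E) hg hC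
  exact hT.unique (hS.isIntegral hg hC) ▸ hS

lemma _root_.Measurable.star_complex {α : Type*} [MeasurableSpace α] {g : α → ℂ}
    (hg : Measurable g) : Measurable (star g) :=
  Complex.continuous_conj.measurable.comp hg

/-- Apply `HasIntegral` for `star T` to the test operator `E.proj s` and take adjoints. Integrals
then become test operators themselves, whence `IsIntegral.mul`. -/
lemma IsIntegral.multiplies {g : ℝ → ℂ} {T : H →L[ℂ] H} (hT : E.IsIntegral g T)
    (hg : Measurable g) {C : ℝ} (hC : ∀ l, ‖g l‖ ≤ C) : E.Multiplies g T := by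
  refine fun ψ => ⟨(hT ψ).1, fun s hs => ?_⟩
  have h1 := (hT.star.hasIntegral (C := C) hg.star_complex (fun l => by simpa using hC l)) _ _
    (multiplies_proj hs) ψ
  have hsa : ContinuousLinearMap.adjoint (E.proj s) = E.proj s := (E.isStarProjection s hs).isSelfAdjoint
  rw [← ContinuousLinearMap.adjoint_inner_left, ← inner_conj_symm, ← hsa,
    ContinuousLinearMap.adjoint_inner_left, ← ContinuousLinearMap.star_eq_adjoint T, h1,
    ← integral_conj, ← integral_indicator hs]
  congr 1
  ext l
  by_cases hl : l ∈ s <;> simp [hl]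

lemma IsIntegral.mul {g h : ℝ → ℂ} {S T : H →L[ℂ] H} (hS : E.IsIntegral g S)
    (hT : E.IsIntegral h T) (hg : Measurable g) (hh : Measurable h) {C D : ℝ}
    (hC : ∀ l, ‖g l‖ ≤ C) (hD : ∀ l, ‖h l‖ ≤ D) : E.IsIntegral (g * h) (S * T) := by
  refine fun ψ => ⟨?_, hT.hasIntegral hh hD g S (hS.multiplies hg hC) ψ⟩
  exact (hS ψ).1.mul_bdd hh.aestronglyMeasurable (Eventually.of_forall hD)

lemma isIntegral_proj {t : Set ℝ} (ht : MeasurableSet t) :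
    E.IsIntegral (t.indicator 1) (E.proj t) := by
  refine fun ψ => ⟨(multiplies_proj ht ψ).1, ?_⟩
  rw [E.inner_proj ht, integral_indicator ht]
  simp

/-- The measure of `s` on the left is the quadratic form of `T* E(s) T`, which by multiplicativity
integrates `|g|² 1_s`. -/
lemma measure_isIntegral_apply {g : ℝ → ℂ} {T : H →L[ℂ] H} (hT : E.IsIntegral g T)
    (hg : Measurable g) {C : ℝ} (hC : ∀ l, ‖g l‖ ≤ C) (ψ : H) :
    E.measure (T ψ) = (E.measure ψ).withDensity fun l => ‖g l‖ₑ ^ 2 := by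
  ext s hs
  have h1 := (hT.star.mul ((isIntegral_proj hs).mul hT
    (measurable_one.indicator hs) hg (C := 1) (fun l => by
      by_cases hl : l ∈ s <;> simp [hl]) hC) hg.star_complex
    ((measurable_one.indicator hs).mul hg) (C := C) (D := 1 * C) (fun l => by simpa using hC l)
    (fun l => by
      have := hC l
      by_cases hl : l ∈ s <;> simp [hl, this]
      exact (norm_nonneg _).trans this))
  have h2 := (h1 ψ).2
  rw [mul_apply_eq_comp, ContinuousLinearMap.star_eq_adjoint,
    ContinuousLinearMap.adjoint_inner_right, mul_apply_eq_comp, E.inner_proj hs] at h2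
  have h3 : ∫ l, (star g * (s.indicator 1 * g) : ℝ → ℂ) l ∂(E.measure ψ) =
      ((∫ l in s, ‖g l‖ ^ 2 ∂(E.measure ψ) : ℝ) : ℂ) := by
    rw [← integral_complex_ofReal, ← integral_indicator hs]
    congr 1
    ext l
    by_cases hl : l ∈ s <;> simp [hl, Complex.conj_mul']
  rw [h3] at h2
  rw [withDensity_apply _ hs, ← ofReal_measureReal, Complex.ofReal_injective h2,
    ofReal_integral_eq_lintegral_ofReal]
  · congr 1; ext l
    rw [← ofReal_norm, ENNReal.ofReal_pow (norm_nonneg _)]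
  · refine Integrable.of_bound (by fun_prop) (C ^ 2) (Eventually.of_forall fun l => ?_)
    rw [Real.norm_of_nonneg (sq_nonneg _)]
    gcongr
    exact hC l
  · exact Eventually.of_forall fun l => sq_nonneg _

/-- If `g` vanishes off a countable set and `A E({d}) B = 0` for all points `d` of this set, then
`A (∫ g dE) B = 0`. -/
lemma comp_isIntegral_comp_eq_zero {g : ℝ → ℂ} {T : H →L[ℂ] H} (hT : E.IsIntegral g T)
    (hg : Measurable g) {C : ℝ} (hC : ∀ l, ‖g l‖ ≤ C) {D : Set ℝ} (hD : D.Countable)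
    (hgD : ∀ l, l ∉ D → g l = 0) (A B : H →L[ℂ] H)
    (hAB : ∀ d ∈ D, A ∘L E.proj {d} ∘L B = 0) : A ∘L T ∘L B = 0 := by
  obtain ⟨e, he⟩ := Set.countable_iff_exists_injOn.1 hD
  -- Slices of `D` with at most one point each, indexed by `ℕ` to fit the form of countable
  -- additivity.
  let s (n : ℕ) : Set ℝ := D ∩ e ⁻¹' {n}
  have hs_sub (n : ℕ) : (s n).Subsingleton := fun x hx y hy =>
    he hx.1 hy.1 (by rw [hx.2, hy.2])
  have hs (n : ℕ) : MeasurableSet (s n) := (hs_sub n).measurableSet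
  have hsD : ⋃ n, s n = D := by
    ext x; simp [s]
  have hsd : Pairwise (Function.onFun Disjoint s) := by
    intro i j hij
    refine Set.disjoint_left.2 fun x hx hy => hij ?_
    rw [← hx.2, ← hy.2]
  have hDm : MeasurableSet D := hD.measurableSet
  have h1 : ∀ t : Set ℝ, ∀ l, ‖(t.indicator 1 l : ℂ)‖ ≤ 1 := fun t l => by
    by_cases hl : l ∈ t <;> simp [hl]
  have hTD : T * E.proj D = T := by
    refine IsIntegral.unique (E := E) (g := g) ?_ hT
    convert hT.mul (isIntegral_proj hDm) hg (measurable_one.indicator hDm) hC (h1 D) using 1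
    ext l
    by_cases hl : l ∈ D <;> simp [hl, hgD]
  have hTs (n : ℕ) : A ∘L (T * E.proj (s n)) ∘L B = 0 := by
    rcases (hs_sub n).eq_empty_or_singleton with h | ⟨d, hd⟩
    · rw [h, E.proj_empty]; simp
    · have hdD : d ∈ D := ((hd ▸ mem_singleton d : d ∈ s n)).1
      have : T * E.proj (s n) = g d • E.proj {d} := by
        refine IsIntegral.unique (E := E) (g := g * (s n).indicator 1)
          (hT.mul (isIntegral_proj (hs n)) hg (measurable_one.indicator (hs n)) hC (h1 _)) ?_
        have e1 : g * (s n).indicator 1 = fun l => g d * ({d} : Set ℝ).indicator 1 l := by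
          rw [hd]
          ext l
          by_cases hl : l = d <;> simp [hl]
        intro ψ
        have h2 := isIntegral_proj (E := E) (measurableSet_singleton d) ψ
        rw [e1, _root_.smul_apply, inner_smul_right, integral_const_mul, h2.2]
        exact ⟨h2.1.const_mul _, rfl⟩
      rw [this, ContinuousLinearMap.smul_comp, ContinuousLinearMap.comp_smul, hAB d hdD, smul_zero]
  ext ψ
  -- Strong countable additivity sums the vanishing slices to `A T E(D) B = 0`, and `T E(D) = T`
  -- because `g` vanishes off `D`.
  have h2 := (E.hasSum_iUnion s hs hsd (B ψ)).mapL (A ∘L T)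
  have h3 (n : ℕ) : (A ∘L T) (E.proj (s n) (B ψ)) = 0 := DFunLike.congr_fun (hTs n) ψ
  simp_rw [h3] at h2
  have h4 := h2.unique hasSum_zero
  rw [hsD] at h4
  have h5 : (A ∘L (T * E.proj D) ∘L B) ψ = 0 := h4
  rwa [hTD] at h5

end ProjectionValuedMeasure

end Calculus

/-! ### The resolvent as a spectral integral. -/

section SpectralResolvent

variable {H : Type*} [NormedAddCommGroup H] [InnerProductSpace ℂ H] [CompleteSpace H]

lemma norm_inv_sub_le {z : ℂ} (h : z.im ≠ 0) (l : ℝ) : ‖((l : ℂ) - z)⁻¹‖ ≤ |z.im|⁻¹ := by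
  rw [norm_inv]
  refine inv_anti₀ (abs_pos.2 h) ?_
  have := Complex.abs_im_le_norm ((l : ℂ) - z)
  simpa using this

lemma sub_ne_zero_of_im_ne_zero {z : ℂ} (hz : z.im ≠ 0) (l : ℝ) : (l : ℂ) - z ≠ 0 := by
  intro h
  apply hz
  have := congrArg Complex.im h
  simpa using this

namespace ProjectionValuedMeasure

variable {E : ProjectionValuedMeasure H} {K : H →ₗ.[ℂ] H}

lemma measurable_inv_sub (z : ℂ) : Measurable fun l : ℝ => ((l : ℂ) - z)⁻¹ := by fun_prop

/-- Let `T = ∫ (l - z)⁻¹ dE`, which maps into the domain of `K`, and let `L = (K - z)T - 1`. The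
spectral measure gives only quadratic forms of `K`, hence only `⟨Tψ, Lψ⟩ = 0`. Thus `T* L` has zero
quadratic form and vanishes; since `T*` is injective, `L = 0`. -/
theorem IsSpectralMeasureOf.isIntegral_resolventOp (hE : E.IsSpectralMeasureOf K)
    (hK : IsSelfAdjoint K) {z : ℂ} (hz : z.im ≠ 0) :
    E.IsIntegral (fun l => ((l : ℂ) - z)⁻¹) (resolventOp K z) := by
  have hz0 (l : ℝ) := sub_ne_zero_of_im_ne_zero hz l
  obtain ⟨T, hT⟩ := exists_isIntegral (E := E) (measurable_inv_sub z) (norm_inv_sub_le hz)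
  have hTstar := hT.star
  have hden (ψ : H) := measure_isIntegral_apply hT (measurable_inv_sub z) (norm_inv_sub_le hz) ψ
  have hden' : (fun l : ℝ => ‖((l : ℂ) - z)⁻¹‖ₑ ^ 2) =
      fun l : ℝ => ((‖((l : ℂ) - z)⁻¹‖₊ ^ 2 : NNReal) : ENNReal) := by
    ext x; simp only [enorm_eq_nnnorm, ENNReal.coe_pow]
  have hdm : Measurable fun l : ℝ => ‖((l : ℂ) - z)⁻¹‖₊ ^ 2 :=
    (measurable_inv_sub z).nnnorm.pow_const 2
  simp_rw [hden'] at hden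
  -- the adjoint of `T` is injective
  have hinj (φ : H) (hφ : ContinuousLinearMap.adjoint T φ = 0) : φ = 0 := by
    have h1 := measure_isIntegral_apply hTstar (measurable_inv_sub z).star_complex
      (C := |z.im|⁻¹) (fun l => by rw [Pi.star_apply, norm_star]; exact norm_inv_sub_le hz l) φ
    have h2 : (E.measure (star T φ)) univ = 0 := by
      rw [ContinuousLinearMap.star_eq_adjoint, hφ, E.measure_apply 0 .univ]
      simp
    rw [h1, withDensity_apply _ .univ, Measure.restrict_univ, lintegral_eq_zero_iff] at h2
    · have h3 : E.measure φ = 0 := by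
        rw [← ae_eq_bot, ← Filter.eventually_false_iff_eq_bot]
        filter_upwards [h2] with l hl
        exact star_ne_zero.2 (inv_ne_zero (hz0 l)) (enorm_eq_zero.1 (pow_eq_zero_iff two_ne_zero |>.1 hl))
      have h4 := E.measureReal_univ φ
      rw [h3] at h4
      simpa using h4.symm
    · exact (measurable_inv_sub z).star_complex.enorm.pow_const 2
  have hdom (ψ : H) : T ψ ∈ K.domain := by
    rw [hE.1, hden, integrable_withDensity_iff_integrable_smul hdm]
    refine Integrable.of_bound (hdm.smul (measurable_id.pow_const 2)).aestronglyMeasurable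
      ((1 + |z.im|⁻¹ * ‖z‖) ^ 2) (Eventually.of_forall fun l => ?_)
    have h1 : (l : ℂ) * ((l : ℂ) - z)⁻¹ = 1 + ((l : ℂ) - z)⁻¹ * z := by
      field_simp [hz0 l]; ring
    have h2 : ‖(l : ℂ) * ((l : ℂ) - z)⁻¹‖ ≤ 1 + |z.im|⁻¹ * ‖z‖ := by
      rw [h1]
      refine (norm_add_le _ _).trans ?_
      rw [norm_one, norm_mul]
      gcongr
      exact norm_inv_sub_le hz l
    rw [NNReal.smul_def, smul_eq_mul, norm_mul, Real.norm_of_nonneg (sq_nonneg _),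
      Real.norm_of_nonneg (NNReal.coe_nonneg _)]
    refine le_trans (le_of_eq ?_) (pow_le_pow_left₀ (norm_nonneg _) h2 2)
    rw [norm_mul, Complex.norm_real, mul_pow, Real.norm_eq_abs, sq_abs, mul_comm]
    rfl
  let L : H →ₗ[ℂ] H :=
    K.toFun ∘ₗ (T : H →ₗ[ℂ] H).codRestrict K.domain hdom - z • (T : H →ₗ[ℂ] H) - LinearMap.id
  have hL (ψ : H) : L ψ = K ⟨T ψ, hdom ψ⟩ - z • T ψ - ψ := rfl
  have hquad (ψ : H) : inner ℂ (T ψ) (L ψ) = 0 := by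
    have h1 := hE.2 ⟨T ψ, hdom ψ⟩
    have h1' := (hE.1 _).1 (hdom ψ)
    rw [hden, integral_withDensity_eq_integral_smul hdm] at h1
    have h2 : inner ℂ (T ψ) (T ψ) = ∫ l, ((‖((l : ℂ) - z)⁻¹‖₊ ^ 2 : NNReal) : ℂ) ∂(E.measure ψ) := by
      have h3 := E.inner_proj .univ (T ψ)
      rw [E.proj_univ, one_apply_eq_self, hden] at h3
      rw [h3, measureReal_def, withDensity_apply _ .univ, Measure.restrict_univ,
        ← integral_toReal, ← integral_complex_ofReal]
      · rfl
      · exact hdm.coe_nnreal_ennreal.aemeasurable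
      · exact Eventually.of_forall fun l => ENNReal.coe_lt_top
    have h4 : inner ℂ (T ψ) ψ = ∫ l, star (((l : ℂ) - z)⁻¹) ∂(E.measure ψ) := by
      rw [← ContinuousLinearMap.adjoint_inner_right, ← ContinuousLinearMap.star_eq_adjoint,
        (hTstar ψ).2]
      rfl
    have hi4 : Integrable (fun l : ℝ => star (((l : ℂ) - z)⁻¹)) (E.measure ψ) := (hTstar ψ).1
    have hi2 : Integrable (fun l : ℝ => ((‖((l : ℂ) - z)⁻¹‖₊ ^ 2 : NNReal) : ℂ)) (E.measure ψ) := by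
      refine Integrable.of_bound (by fun_prop) (|z.im|⁻¹ ^ 2) (Eventually.of_forall fun l => ?_)
      have : ‖(((‖((l : ℂ) - z)⁻¹‖₊ ^ 2 : NNReal) : ℝ) : ℂ)‖ = ‖((l : ℂ) - z)⁻¹‖ ^ 2 := by
        rw [Complex.norm_real, Real.norm_of_nonneg (NNReal.coe_nonneg _)]; simp
      exact this.le.trans (pow_le_pow_left₀ (norm_nonneg _) (norm_inv_sub_le hz l) 2)
    have hkey (l : ℝ) : (‖((l : ℂ) - z)⁻¹‖₊ ^ 2 : NNReal) • (l : ℂ) =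
        z * ((‖((l : ℂ) - z)⁻¹‖₊ ^ 2 : NNReal) : ℂ) + star (((l : ℂ) - z)⁻¹) := by
      have h5 : ((‖((l : ℂ) - z)⁻¹‖₊ ^ 2 : NNReal) : ℂ) =
          star (((l : ℂ) - z)⁻¹) * ((l : ℂ) - z)⁻¹ := by
        rw [RCLike.star_def, Complex.conj_mul']
        push_cast
        rfl
      rw [NNReal.smul_def, Complex.real_smul]
      change ((‖((l : ℂ) - z)⁻¹‖₊ ^ 2 : NNReal) : ℂ) * (l : ℂ) = _
      rw [h5]
      have h6 : ((l : ℂ) - z)⁻¹ * ((l : ℂ) - z) = 1 := inv_mul_cancel₀ (hz0 l)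
      linear_combination star (((l : ℂ) - z)⁻¹) * h6
    simp_rw [hkey] at h1
    rw [integral_add (hi2.const_mul z) hi4, integral_const_mul, ← h2, ← h4] at h1
    rw [hL, inner_sub_right, inner_sub_right, inner_smul_right]
    change inner ℂ (T ψ) (K ⟨T ψ, hdom ψ⟩) = _ at h1
    rw [h1]
    ring
  have hL0 : (ContinuousLinearMap.adjoint T : H →ₗ[ℂ] H) ∘ₗ L = 0 := by
    -- Complex polarization for plain linear maps, as `L` is not known to be bounded.
    rw [← inner_map_self_eq_zero]
    intro ψ
    change inner ℂ (ContinuousLinearMap.adjoint T (L ψ)) ψ = 0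
    rw [ContinuousLinearMap.adjoint_inner_left, ← inner_conj_symm, hquad, map_zero]
  have hTR : resolventOp K z = T := by
    ext ψ
    have h1 : L ψ = 0 := hinj _ (LinearMap.congr_fun hL0 ψ)
    rw [hL, sub_eq_zero] at h1
    have h2 := (hK.isResolventAt hz).2 ⟨T ψ, hdom ψ⟩
    rw [h1] at h2
    exact h2
  rw [hTR]
  exact hT

end ProjectionValuedMeasure

end SpectralResolvent

/-! ### Functions of bounded variation and their Stieltjes measures. -/

section BoundedVariation

variable {f : ℝ → ℝ}

lemma BoundedVariationOn.countable_not_continuousAt (hf : BoundedVariationOn f univ) :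
    {x | ¬ ContinuousAt f x}.Countable := by
  obtain ⟨p, q, hp, hq, rfl⟩ := hf.locallyBoundedVariationOn.exists_monotoneOn_sub_monotoneOn
  rw [monotoneOn_univ] at hp hq
  refine (hp.countable_not_continuousAt.union hq.countable_not_continuousAt).mono fun x hx => ?_
  by_contra h
  rw [mem_union, not_or] at h
  exact hx ((not_not.1 h.1).sub (not_not.1 h.2))

lemma BoundedVariationOn.measurable (hf : BoundedVariationOn f univ) : Measurable f :=
  measurable_of_countable_not_continuousAt hf.countable_not_continuousAt

lemma BoundedVariationOn.exists_abs_le (hf : BoundedVariationOn f univ) : ∃ M, ∀ x, |f x| ≤ M := by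
  refine ⟨|f 0| + (eVariationOn f univ).toReal, fun x => ?_⟩
  have h := hf.dist_le (mem_univ x) (mem_univ 0)
  rw [Real.dist_eq] at h
  linarith [abs_sub_abs_le_abs_sub (f x) (f 0)]

/-- The average of the one-sided limits of a function. -/
noncomputable def limAverage (f : ℝ → ℝ) (x : ℝ) : ℝ :=
  (Function.leftLim f x + Function.rightLim f x) / 2

lemma limAverage_eq_of_continuousAt {x : ℝ} (h : ContinuousAt f x) : limAverage f x = f x := by
  rw [limAverage, h.continuousWithinAt.leftLim_eq, h.continuousWithinAt.rightLim_eq]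
  ring

lemma BoundedVariationOn.measurable_limAverage (hf : BoundedVariationOn f univ) :
    Measurable (limAverage f) :=
  hf.measurable.measurable_of_countable_ne <| hf.countable_not_continuousAt.mono fun _ hx h =>
    hx (limAverage_eq_of_continuousAt h).symm

lemma BoundedVariationOn.abs_limAverage_le (hf : BoundedVariationOn f univ) {M : ℝ}
    (hM : ∀ x, |f x| ≤ M) (x : ℝ) : |limAverage f x| ≤ M := by
  have h1 : |Function.leftLim f x| ≤ M :=
    le_of_tendsto (hf.tendsto_leftLim x).abs (Eventually.of_forall hM)
  have h2 : |Function.rightLim f x| ≤ M :=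
    le_of_tendsto (hf.tendsto_rightLim x).abs (Eventually.of_forall hM)
  rw [limAverage, abs_div, abs_two]
  linarith [abs_add_le (Function.leftLim f x) (Function.rightLim f x)]

lemma BoundedVariationOn.vectorMeasure_Ici_eq_neg (hf : BoundedVariationOn f univ)
    (hs : HasCompactSupport f) {x : ℝ} (hx : ContinuousAt f x) :
    hf.vectorMeasure (Ici x) = -f x := by
  have h0 : Tendsto f atTop (𝓝 0) :=
    (hs.is_zero_at_infty).mono_left (by rw [cocompact_eq_atBot_atTop]; exact le_sup_right)
  rw [hf.vectorMeasure_Ici, tendsto_nhds_unique hf.tendsto_atTop_limUnder h0,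
    hx.continuousWithinAt.leftLim_eq, zero_sub]

/-- The positive part of the Lebesgue-Stieltjes measure. -/
noncomputable abbrev BoundedVariationOn.posPart (hf : BoundedVariationOn f univ) : Measure ℝ :=
  (SignedMeasure.toJordanDecomposition hf.vectorMeasure).posPart

/-- The negative part of the Lebesgue-Stieltjes measure. -/
noncomputable abbrev BoundedVariationOn.negPart (hf : BoundedVariationOn f univ) : Measure ℝ :=
  (SignedMeasure.toJordanDecomposition hf.vectorMeasure).negPart

/-- Write `G x` as the integral of `G'` over `t ≤ x` and exchange the integrals. -/
lemma integral_eq_integral_measureReal_Ici (μ : Measure ℝ) [IsFiniteMeasure μ] {G : ℝ → ℂ}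
    (hG : ContDiff ℝ 1 G) (hGs : HasCompactSupport G) :
    ∫ x, G x ∂μ = ∫ t, (μ.real (Ici t) : ℂ) * deriv G t := by
  have hd : Integrable (deriv G) :=
    (hG.continuous_deriv le_rfl).integrable_of_hasCompactSupport hGs.deriv
  have hint : Integrable (fun p : ℝ × ℝ => {p : ℝ × ℝ | p.2 ≤ p.1}.indicator
      (fun p => deriv G p.2) p) (μ.prod volume) :=
    (hd.comp_snd μ).indicator (measurableSet_le measurable_snd measurable_fst)
  have h1 (x : ℝ) : G x = ∫ t, {p : ℝ × ℝ | p.2 ≤ p.1}.indicator (fun p => deriv G p.2) (x, t) := by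
    rw [← hGs.integral_Iic_deriv_eq hG x, ← integral_indicator measurableSet_Iic]
    rfl
  simp_rw [h1]
  rw [integral_integral_swap hint]
  congr 1
  ext t
  have : (fun x => {p : ℝ × ℝ | p.2 ≤ p.1}.indicator (fun p => deriv G p.2) (x, t)) =
      (Ici t).indicator fun _ => deriv G t := rfl
  rw [this, integral_indicator measurableSet_Ici, setIntegral_const, Complex.real_smul]

/-- Integration by parts for the Lebesgue-Stieltjes measure. -/
lemma BoundedVariationOn.integral_posPart_sub_integral_negPart (hf : BoundedVariationOn f univ)
    (hs : HasCompactSupport f) {G : ℝ → ℂ} (hG : ContDiff ℝ 1 G) (hGs : HasCompactSupport G) :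
    ∫ x, G x ∂hf.posPart - ∫ x, G x ∂hf.negPart = -∫ x, (f x : ℂ) * deriv G x := by
  have hd : Integrable (deriv G) :=
    (hG.continuous_deriv le_rfl).integrable_of_hasCompactSupport hGs.deriv
  have hint (μ : Measure ℝ) [IsFiniteMeasure μ] :
      Integrable fun t => (μ.real (Ici t) : ℂ) * deriv G t := by
    have hm : Antitone fun t => μ.real (Ici t) := fun s t hst =>
      measureReal_mono (Ici_subset_Ici.2 hst)
    refine hd.bdd_mul (c := μ.real univ)
      (Complex.measurable_ofReal.comp hm.measurable).aestronglyMeasurable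
      (Eventually.of_forall fun t => ?_)
    rw [Complex.norm_real, Real.norm_of_nonneg measureReal_nonneg]
    exact measureReal_mono (subset_univ _)
  rw [integral_eq_integral_measureReal_Ici _ hG hGs, integral_eq_integral_measureReal_Ici _ hG hGs,
    ← integral_sub (hint _) (hint _), ← integral_neg]
  refine integral_congr_ae ?_
  -- At continuity points `df([t, ∞)) = -f t`; the other points are Lebesgue null.
  filter_upwards [hf.countable_not_continuousAt.ae_notMem volume] with t ht
  have ht' : ContinuousAt f t := not_not.1 ht
  have h1 := SignedMeasure.apply_eq_posPart_real_sub_negPart_real hf.vectorMeasure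
    (measurableSet_Ici (a := t))
  rw [hf.vectorMeasure_Ici_eq_neg hs ht'] at h1
  rw [← sub_mul, ← Complex.ofReal_sub, ← h1]
  push_cast
  ring

end BoundedVariation

/-! ### Poisson integrals and their boundary values. -/

section Poisson

variable {f : ℝ → ℝ}

/-- The Poisson integral of `f`, up to the factor `π`. -/
noncomputable def poissonIntegral (f : ℝ → ℝ) (ε l : ℝ) : ℝ :=
  ∫ t, f (l + ε * t) * (1 + t ^ 2)⁻¹

lemma abs_poissonIntegral_le {M : ℝ} (hM : ∀ x, |f x| ≤ M) (ε l : ℝ) :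
    |poissonIntegral f ε l| ≤ M * Real.pi := by
  rw [← integral_univ_inv_one_add_sq, ← integral_const_mul, ← Real.norm_eq_abs]
  refine norm_integral_le_of_norm_le (integrable_inv_one_add_sq.const_mul M)
    (Eventually.of_forall fun t => ?_)
  rw [norm_mul, Real.norm_eq_abs, Real.norm_of_nonneg (by positivity)]
  gcongr
  exact hM _

/-- In the rescaled variable, `t > 0` sees the right limit and `t < 0` the left one, and each
half-line carries mass `π / 2`. Domination is by `M (1 + t²)⁻¹`. -/
lemma BoundedVariationOn.tendsto_poissonIntegral (hf : BoundedVariationOn f univ) (l : ℝ) :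
    Tendsto (fun ε => poissonIntegral f ε l) (𝓝[>] 0) (𝓝 (Real.pi * limAverage f l)) := by
  obtain ⟨M, hM⟩ := hf.exists_abs_le
  have hI : Integrable fun t : ℝ => (1 + t ^ 2)⁻¹ := integrable_inv_one_add_sq
  have hval : Real.pi * limAverage f l =
      ∫ t, (if 0 < t then Function.rightLim f l else Function.leftLim f l) * (1 + t ^ 2)⁻¹ := by
    have h1 : ∫ t in Ioi 0, (if 0 < t then Function.rightLim f l else Function.leftLim f l) *
        (1 + t ^ 2)⁻¹ = Function.rightLim f l * (Real.pi / 2) := by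
      rw [setIntegral_congr_fun (g := fun t => Function.rightLim f l * (1 + t ^ 2)⁻¹)
        measurableSet_Ioi fun t ht => by simp [show 0 < t from ht], integral_const_mul,
        integral_Ioi_inv_one_add_sq]
      simp
    have h2 : ∫ t in Iic 0, (if 0 < t then Function.rightLim f l else Function.leftLim f l) *
        (1 + t ^ 2)⁻¹ = Function.leftLim f l * (Real.pi / 2) := by
      rw [setIntegral_congr_fun (g := fun t => Function.leftLim f l * (1 + t ^ 2)⁻¹)
        measurableSet_Iic fun t ht => by simp [not_lt.2 (show t ≤ 0 from ht)], integral_const_mul,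
        integral_Iic_inv_one_add_sq]
      simp
    rw [← integral_add_compl (measurableSet_Ioi (a := (0 : ℝ))), compl_Ioi, h1, h2, limAverage]
    · ring
    · refine hI.bdd_mul (c := max |Function.rightLim f l| |Function.leftLim f l|) ?_
        (Eventually.of_forall fun t => ?_)
      · exact (Measurable.ite measurableSet_Ioi measurable_const
          measurable_const).aestronglyMeasurable
      · split_ifs <;> simp
  rw [hval]
  refine tendsto_integral_filter_of_dominated_convergence (fun t => M * (1 + t ^ 2)⁻¹)
    (Eventually.of_forall fun ε => ?_) (Eventually.of_forall fun ε => Eventually.of_forall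
      fun t => ?_) (hI.const_mul M) ?_
  · exact ((hf.measurable.comp (by fun_prop)).mul (by fun_prop)).aestronglyMeasurable
  · rw [norm_mul, Real.norm_eq_abs, Real.norm_of_nonneg (by positivity)]
    gcongr
    exact hM _
  · filter_upwards [(countable_singleton (0 : ℝ)).ae_notMem volume] with t ht
    have ht0 : t ≠ 0 := ht
    refine Tendsto.mul_const _ ?_
    have hcont : Tendsto (fun ε : ℝ => l + ε * t) (𝓝[>] 0) (𝓝 l) := by
      have : Continuous fun ε : ℝ => l + ε * t := by fun_prop
      have h := this.tendsto 0
      simp only [zero_mul, add_zero] at h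
      exact h.mono_left nhdsWithin_le_nhds
    rcases lt_or_gt_of_ne ht0 with h | h
    · rw [if_neg (not_lt.2 h.le)]
      refine (hf.tendsto_leftLim l).comp (tendsto_nhdsWithin_iff.2 ⟨hcont, ?_⟩)
      filter_upwards [self_mem_nhdsWithin] with ε hε
      have := mul_neg_of_pos_of_neg (show 0 < ε from hε) h
      simp only [mem_Iio]; linarith
    · rw [if_pos h]
      refine (hf.tendsto_rightLim l).comp (tendsto_nhdsWithin_iff.2 ⟨hcont, ?_⟩)
      filter_upwards [self_mem_nhdsWithin] with ε hε
      have := mul_pos (show 0 < ε from hε) h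
      simp only [mem_Ioi]; linarith

/-- The difference of the two Cauchy kernels is `-2i ε / ((x - l)² + ε²)`; substitute `x = l + ε t`.
-/
lemma integral_mul_inv_sub_inv_eq_poissonIntegral {ε : ℝ} (hε : 0 < ε) (l : ℝ) :
    ∫ x, (f x : ℂ) * (((l : ℂ) - (x + Complex.I * (-ε : ℝ)))⁻¹ -
        ((l : ℂ) - (x + Complex.I * ε))⁻¹) =
      -2 * Complex.I * poissonIntegral f ε l := by
  have h1 (x : ℝ) : (f x : ℂ) * (((l : ℂ) - (x + Complex.I * (-ε : ℝ)))⁻¹ -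
        ((l : ℂ) - (x + Complex.I * ε))⁻¹) =
      -2 * Complex.I * ((f x * (ε / ((x - l) ^ 2 + ε ^ 2)) : ℝ) : ℂ) := by
    have ha : (l : ℂ) - (x + Complex.I * (-ε : ℝ)) ≠ 0 := fun h => by
      have := congrArg Complex.im h
      simp at this
      exact hε.ne' this
    have hb : (l : ℂ) - (x + Complex.I * ε) ≠ 0 := fun h => by
      have := congrArg Complex.im h
      simp at this
      exact hε.ne' this
    have hab : (((x - l) ^ 2 + ε ^ 2 : ℝ) : ℂ) =
        ((l : ℂ) - (x + Complex.I * (-ε : ℝ))) * ((l : ℂ) - (x + Complex.I * ε)) := by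
      push_cast
      linear_combination (ε : ℂ) ^ 2 * Complex.I_sq
    rw [Complex.ofReal_mul, Complex.ofReal_div, hab, inv_sub_inv ha hb]
    push_cast
    ring
  simp_rw [h1]
  rw [integral_const_mul, integral_complex_ofReal, poissonIntegral]
  congr 2
  let g : ℝ → ℝ := fun y => f (l + y) * (1 + (y / ε) ^ 2)⁻¹
  have h2 (t : ℝ) : f (l + ε * t) * (1 + t ^ 2)⁻¹ = g (ε * t) := by
    simp only [g, mul_div_cancel_left₀ t hε.ne']
  have h3 (x : ℝ) : f (l + x) * (ε / ((l + x - l) ^ 2 + ε ^ 2)) = ε⁻¹ * g x := by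
    have : (l + x - l) ^ 2 + ε ^ 2 = ε ^ 2 * (1 + (x / ε) ^ 2) := by field_simp; ring
    simp only [g]
    rw [this]
    field_simp
  simp_rw [h2]
  rw [Measure.integral_comp_mul_left g ε, abs_of_pos (inv_pos.2 hε),
    ← integral_add_left_eq_self _ l]
  simp_rw [h3]
  rw [integral_const_mul, smul_eq_mul]

end Poisson

/-! ### The cut off scalar integral against `ζ_f`. -/

section CauchyKernel

/-- The Cauchy kernel `(l - x - iy)⁻¹`. -/
noncomputable def cauchyKernel (l : ℝ) (p : ℝ × ℝ) : ℂ := ((l : ℂ) - (p.1 + Complex.I * p.2))⁻¹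

/-- The Cauchy kernel, cut off at `|y| ≤ ε`. -/
noncomputable def cutoffKernel (ε l : ℝ) (p : ℝ × ℝ) : ℂ :=
  {p : ℝ × ℝ | ε < |p.2|}.indicator (cauchyKernel l) p

lemma measurableSet_lt_abs_snd (ε : ℝ) : MeasurableSet {p : ℝ × ℝ | ε < |p.2|} :=
  measurableSet_lt measurable_const (by fun_prop)

lemma measurable_cauchyKernel (l : ℝ) : Measurable (cauchyKernel l) := by
  unfold cauchyKernel; fun_prop

lemma measurable_cutoffKernel (ε l : ℝ) : Measurable (cutoffKernel ε l) :=
  (measurable_cauchyKernel l).indicator (measurableSet_lt_abs_snd ε)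

lemma cutoffKernel_of_lt {ε l : ℝ} {p : ℝ × ℝ} (h : ε < |p.2|) :
    cutoffKernel ε l p = cauchyKernel l p := indicator_of_mem (s := {p : ℝ × ℝ | ε < |p.2|}) h _

lemma cutoffKernel_of_le {ε l : ℝ} {p : ℝ × ℝ} (h : |p.2| ≤ ε) :
    cutoffKernel ε l p = 0 :=
  indicator_of_notMem (s := {p : ℝ × ℝ | ε < |p.2|}) (not_lt.2 h) _

lemma norm_cutoffKernel_le {ε : ℝ} (hε : 0 < ε) (l : ℝ) (p : ℝ × ℝ) :
    ‖cutoffKernel ε l p‖ ≤ ε⁻¹ := by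
  rcases lt_or_ge ε |p.2| with h | h
  · rw [cutoffKernel_of_lt h, cauchyKernel]
    have him : ((p.1 : ℂ) + Complex.I * p.2).im = p.2 := by simp
    have h0 : ((p.1 : ℂ) + Complex.I * p.2).im ≠ 0 := by
      rw [him]; exact abs_pos.1 (hε.trans h)
    refine (norm_inv_sub_le h0 l).trans ?_
    rw [him]
    exact inv_anti₀ hε h.le
  · rw [cutoffKernel_of_le h, norm_zero]
    positivity

lemma cauchyKernel_denom_ne_zero (l x : ℝ) {y : ℝ} (hy : y ≠ 0) :
    (l : ℂ) - (x + Complex.I * y) ≠ 0 := by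
  apply sub_ne_zero_of_im_ne_zero
  simpa using hy

lemma hasDerivAt_cauchyKernel_fst (l x : ℝ) {y : ℝ} (hy : y ≠ 0) :
    HasDerivAt (fun x => cauchyKernel l (x, y)) (cauchyKernel l (x, y) ^ 2) x := by
  have h : HasDerivAt (fun x : ℝ => (l : ℂ) - (x + Complex.I * y)) (-1) x := by
    simpa using ((Complex.ofRealCLM.hasDerivAt (x := x)).add_const (Complex.I * y)).const_sub (l : ℂ)
  refine (h.inv (cauchyKernel_denom_ne_zero l x hy)).congr_deriv ?_
  rw [neg_neg, cauchyKernel, div_eq_mul_inv, inv_pow]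
  exact one_mul _

lemma hasDerivAt_cauchyKernel_snd (l x : ℝ) {y : ℝ} (hy : y ≠ 0) :
    HasDerivAt (fun y => cauchyKernel l (x, y)) (Complex.I * cauchyKernel l (x, y) ^ 2) y := by
  have h : HasDerivAt (fun y : ℝ => (l : ℂ) - (x + Complex.I * y)) (-Complex.I) y := by
    simpa using (((Complex.ofRealCLM.hasDerivAt (x := y)).const_mul Complex.I).const_add
      (x : ℂ)).const_sub (l : ℂ)
  refine (h.inv (cauchyKernel_denom_ne_zero l x hy)).congr_deriv ?_
  rw [neg_neg, cauchyKernel, div_eq_mul_inv, inv_pow]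

variable {Ξ : ℝ × ℝ → ℂ}

lemma hasDerivAt_fst (hΞ : ContDiff ℝ ∞ Ξ) (x y : ℝ) :
    HasDerivAt (fun x => Ξ (x, y)) (fderiv ℝ Ξ (x, y) (1, 0)) x :=
  ((hΞ.differentiable (by simp)) (x, y)).hasFDerivAt.comp_hasDerivAt x
    ((hasDerivAt_id x).prodMk (hasDerivAt_const x y))

lemma hasDerivAt_snd (hΞ : ContDiff ℝ ∞ Ξ) (x y : ℝ) :
    HasDerivAt (fun y => Ξ (x, y)) (fderiv ℝ Ξ (x, y) (0, 1)) y :=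
  ((hΞ.differentiable (by simp)) (x, y)).hasFDerivAt.comp_hasDerivAt y
    ((hasDerivAt_const y x).prodMk (hasDerivAt_id y))

lemma continuous_fderiv_apply (hΞ : ContDiff ℝ ∞ Ξ) (v : ℝ × ℝ) :
    Continuous fun p => fderiv ℝ Ξ p v :=
  (hΞ.continuous_fderiv (by simp)).clm_apply continuous_const

lemma hasCompactSupport_fderiv_apply (hΞs : HasCompactSupport Ξ) (v : ℝ × ℝ) :
    HasCompactSupport fun p => fderiv ℝ Ξ p v :=
  (hΞs.fderiv (𝕜 := ℝ)).comp_left (g := fun L : ℝ × ℝ →L[ℝ] ℂ => L v) (by simp)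

lemma HasCompactSupport.comp_mk_left {α : Type*} [TopologicalSpace α] [T2Space α] {h : ℝ × α → ℂ}
    (hs : HasCompactSupport h) (y : α) : HasCompactSupport fun x => h (x, y) := by
  refine HasCompactSupport.intro (hs.isCompact.image continuous_fst) fun x hx => ?_
  by_contra h0
  exact hx ⟨(x, y), subset_tsupport h h0, rfl⟩

lemma HasCompactSupport.comp_mk_right {h : ℝ × ℝ → ℂ}
    (hs : HasCompactSupport h) (x : ℝ) : HasCompactSupport fun y => h (x, y) := by
  refine HasCompactSupport.intro (hs.isCompact.image continuous_snd) fun y hy => ?_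
  by_contra h0
  exact hy ⟨(x, y), subset_tsupport h h0, rfl⟩

lemma integrable_mul_cutoffKernel (μ : Measure (ℝ × ℝ)) {h : ℝ × ℝ → ℂ} (hh : Integrable h μ)
    {ε : ℝ} (hε : 0 < ε) (l : ℝ) : Integrable (fun p => h p * cutoffKernel ε l p) μ :=
  hh.mul_bdd (measurable_cutoffKernel ε l).aestronglyMeasurable
    (Eventually.of_forall (norm_cutoffKernel_le hε l))

variable {f : ℝ → ℝ}

lemma BoundedVariationOn.integrable_mul {α : Type*} [MeasurableSpace α]
    (hf : BoundedVariationOn f univ) {μ : Measure α} {h : α → ℂ} (hh : Integrable h μ)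
    {u : α → ℝ} (hu : Measurable u) : Integrable (fun a => (f (u a) : ℂ) * h a) μ := by
  obtain ⟨M, hM⟩ := hf.exists_abs_le
  refine hh.bdd_mul (c := M)
    (Complex.measurable_ofReal.comp (hf.measurable.comp hu)).aestronglyMeasurable
    (Eventually.of_forall fun a => ?_)
  rw [Complex.norm_real]
  exact hM _

/-- The derivative in the direction of `y` of the product `Ξ(x, y) (l - x - iy)⁻¹`, cut off. -/
noncomputable def cutoffDeriv (Ξ : ℝ × ℝ → ℂ) (ε l : ℝ) (p : ℝ × ℝ) : ℂ :=
  fderiv ℝ Ξ p (0, 1) * cutoffKernel ε l p + Complex.I * (Ξ p * cutoffKernel ε l p *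
    cutoffKernel ε l p)

lemma integrable_cutoffDeriv (hΞ : ContDiff ℝ ∞ Ξ) (hΞs : HasCompactSupport Ξ) {ε : ℝ}
    (hε : 0 < ε) (l : ℝ) : Integrable (cutoffDeriv Ξ ε l) := by
  have h1 : Integrable Ξ := hΞ.continuous.integrable_of_hasCompactSupport hΞs
  have h2 : Integrable fun p => fderiv ℝ Ξ p (0, 1) :=
    (continuous_fderiv_apply hΞ _).integrable_of_hasCompactSupport
      (hasCompactSupport_fderiv_apply hΞs _)
  exact (integrable_mul_cutoffKernel _ h2 hε l).add
    ((integrable_mul_cutoffKernel _ (integrable_mul_cutoffKernel _ h1 hε l) hε l).const_mul _)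

/-- The fundamental theorem of calculus on the two half-lines of `|y| > ε`; the ends at infinity
vanish by compact support. -/
lemma integral_cutoffDeriv (hΞ : ContDiff ℝ ∞ Ξ) (hΞs : HasCompactSupport Ξ) {ε : ℝ}
    (hε : 0 < ε) (l x : ℝ) : ∫ y, cutoffDeriv Ξ ε l (x, y) =
      Ξ (x, -ε) * cauchyKernel l (x, -ε) - Ξ (x, ε) * cauchyKernel l (x, ε) := by
  have hbd (h : ℝ × ℝ → ℂ) (hh : Integrable fun y => h (x, y)) :
      Integrable fun y => h (x, y) * cutoffKernel ε l (x, y) :=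
    have hm : AEStronglyMeasurable (fun y => cutoffKernel ε l (x, y)) volume :=
      ((measurable_cutoffKernel ε l).comp measurable_prodMk_left).aestronglyMeasurable
    hh.mul_bdd hm (Eventually.of_forall fun y => norm_cutoffKernel_le hε l _)
  have h1 : Integrable fun y => Ξ (x, y) :=
    (hΞ.continuous.comp (by fun_prop)).integrable_of_hasCompactSupport (hΞs.comp_mk_right x)
  have h2 : Integrable fun y => fderiv ℝ Ξ (x, y) (0, 1) :=
    ((continuous_fderiv_apply hΞ (0, 1)).comp (by fun_prop : Continuous fun y : ℝ => (x, y))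
      ).integrable_of_hasCompactSupport
      ((hasCompactSupport_fderiv_apply hΞs (0, 1)).comp_mk_right x)
  have hint : Integrable fun y => cutoffDeriv Ξ ε l (x, y) :=
    (hbd (fun p => fderiv ℝ Ξ p (0, 1)) h2).add
      ((hbd (fun p => Ξ p * cutoffKernel ε l p) (hbd Ξ h1)).const_mul Complex.I)
  let D (y : ℝ) : ℂ := fderiv ℝ Ξ (x, y) (0, 1) * cauchyKernel l (x, y) +
    Ξ (x, y) * (Complex.I * cauchyKernel l (x, y) ^ 2)
  have hD (y : ℝ) (hy : ε < |y|) : cutoffDeriv Ξ ε l (x, y) = D y := by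
    simp only [cutoffDeriv, D]
    rw [cutoffKernel_of_lt (p := (x, y)) hy]
    ring
  have hD0 (y : ℝ) (hy : |y| ≤ ε) : cutoffDeriv Ξ ε l (x, y) = 0 := by
    simp only [cutoffDeriv]
    rw [cutoffKernel_of_le (p := (x, y)) hy]
    ring
  have hder (y : ℝ) (hy : y ≠ 0) :
      HasDerivAt (fun y => Ξ (x, y) * cauchyKernel l (x, y)) (D y) y :=
    (hasDerivAt_snd hΞ x y).mul (hasDerivAt_cauchyKernel_snd l x hy)
  have hcs : HasCompactSupport fun y => Ξ (x, y) * cauchyKernel l (x, y) :=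
    (hΞs.comp_mk_right x).mul_right
  rw [hasCompactSupport_iff_eventuallyEq, coclosedCompact_eq_cocompact,
    cocompact_eq_atBot_atTop] at hcs
  have htop := (hcs.filter_mono le_sup_right).tendsto
  have hbot := (hcs.filter_mono le_sup_left).tendsto
  have hsub : (Ioi ε ∪ Iic (-ε) : Set ℝ) =ᵐ[volume] ({y : ℝ | ε < |y|} : Set ℝ) := by
    filter_upwards [(countable_singleton (-ε)).ae_notMem volume] with y hy
    have hy' : y ≠ -ε := hy
    apply propext
    change (ε < y ∨ y ≤ -ε) ↔ ε < |y|
    rw [lt_abs]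
    constructor
    · rintro (h | h)
      · exact Or.inl h
      · exact Or.inr (by have := lt_of_le_of_ne h hy'; linarith)
    · rintro (h | h)
      · exact Or.inl h
      · exact Or.inr (by linarith)
  have hms : MeasurableSet {y : ℝ | ε < |y|} := measurableSet_lt measurable_const (by fun_prop)
  have e1 : ∫ y, cutoffDeriv Ξ ε l (x, y) = ∫ y in {y : ℝ | ε < |y|}, cutoffDeriv Ξ ε l (x, y) := by
    rw [← integral_indicator hms]
    congr 1
    ext y
    by_cases hy : ε < |y|
    · rw [indicator_of_mem (s := {y : ℝ | ε < |y|}) hy]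
    · rw [indicator_of_notMem (s := {y : ℝ | ε < |y|}) hy, hD0 y (not_lt.1 hy)]
  rw [e1, ← setIntegral_congr_set hsub, setIntegral_union
    (by rw [Set.disjoint_left]; intro y h1 h2; simp only [mem_Ioi, mem_Iic] at h1 h2; linarith)
    measurableSet_Iic hint.integrableOn hint.integrableOn]
  have e2 : ∫ y in Ioi ε, cutoffDeriv Ξ ε l (x, y) = 0 - Ξ (x, ε) * cauchyKernel l (x, ε) := by
    have hc : ∀ y ∈ Ioi ε, cutoffDeriv Ξ ε l (x, y) = D y := fun y hy =>
      hD y (lt_abs.2 (Or.inl hy))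
    rw [setIntegral_congr_fun measurableSet_Ioi hc]
    exact integral_Ioi_of_hasDerivAt_of_tendsto'
      (fun y hy => hder y (hε.trans_le hy).ne')
      (hint.integrableOn.congr_fun hc measurableSet_Ioi) htop
  have e3 : ∫ y in Iic (-ε), cutoffDeriv Ξ ε l (x, y) =
      Ξ (x, -ε) * cauchyKernel l (x, -ε) - 0 := by
    have hc : ∀ y ∈ Iio (-ε), cutoffDeriv Ξ ε l (x, y) = D y := fun y hy =>
      hD y (lt_abs.2 (Or.inr (by simp only [mem_Iio] at hy; linarith)))
    -- The endpoint `-ε` is dropped while replacing the integrand, because the cut off kernel is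
    -- zero there and `D` need not be.
    rw [integral_Iic_eq_integral_Iio, setIntegral_congr_fun measurableSet_Iio hc,
      ← integral_Iic_eq_integral_Iio]
    refine integral_Iic_of_hasDerivAt_of_tendsto'
      (fun y hy => hder y (by simp only [mem_Iic] at hy; linarith)) ?_ hbot
    rw [integrableOn_Iic_iff_integrableOn_Iio]
    exact hint.integrableOn.congr_fun hc measurableSet_Iio
  rw [e2, e3]
  ring

lemma eventually_eq_one_of_nhdsSet (hf_supp : HasCompactSupport f)
    (hΞ_one : ∀ᶠ p in 𝓝ˢ (tsupport f ×ˢ ({0} : Set ℝ)), Ξ p = 1) :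
    ∃ δ > 0, ∀ y, |y| < δ → ∀ x ∈ tsupport f, Ξ (x, y) = 1 := by
  rw [hf_supp.isCompact.nhdsSet_prod_eq isCompact_singleton, nhdsSet_singleton] at hΞ_one
  obtain ⟨u, hu, v, hv, huv⟩ := eventually_prod_iff.1 hΞ_one
  obtain ⟨δ, hδ, hball⟩ := Metric.eventually_nhds_iff.1 hv
  exact ⟨δ, hδ, fun y hy x hx => huv (hu.self_of_nhdsSet x hx) (hball (by simpa using hy))⟩

/-- The density of the absolutely continuous part of `ζ_f`. -/
noncomputable def zetaDensity (f : ℝ → ℝ) (Ξ : ℝ × ℝ → ℂ) (p : ℝ × ℝ) : ℂ :=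
  (f p.1 : ℂ) * (fderiv ℝ Ξ p (1, 0) + Complex.I * fderiv ℝ Ξ p (0, 1))

/-- The integral of the Cauchy kernel with respect to `ζ_f`, cut off at `|y| ≤ ε`. -/
noncomputable def cutoffIntegral (hf : BoundedVariationOn f univ) (Ξ : ℝ × ℝ → ℂ) (ε l : ℝ) : ℂ :=
  ∫ p, Ξ p * cutoffKernel ε l p ∂(hf.posPart.prod volume) -
    ∫ p, Ξ p * cutoffKernel ε l p ∂(hf.negPart.prod volume) +
    ∫ p, zetaDensity f Ξ p * cutoffKernel ε l p

lemma BoundedVariationOn.integrable_density (hf : BoundedVariationOn f univ)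
    (hΞ : ContDiff ℝ ∞ Ξ) (hΞs : HasCompactSupport Ξ) : Integrable (zetaDensity f Ξ) := by
  have h1 (v : ℝ × ℝ) : Integrable fun p => fderiv ℝ Ξ p v :=
    (continuous_fderiv_apply hΞ _).integrable_of_hasCompactSupport
      (hasCompactSupport_fderiv_apply hΞs _)
  exact hf.integrable_mul ((h1 _).add ((h1 _).const_mul _)) measurable_fst

/-- Integrating `Ξ k` by parts against `df` produces `-f (∂ₓΞ k + Ξ k²)`. The `∂ₓΞ` terms cancel
against the density, and the rest is `i f ∂_y(Ξ k)`, because `∂_y k = i k²`. -/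
lemma integral_section_eq (hf : BoundedVariationOn f univ) (hf_supp : HasCompactSupport f)
    (hΞ : ContDiff ℝ ∞ Ξ) (hΞs : HasCompactSupport Ξ) {ε : ℝ} (hε : 0 < ε) (l y : ℝ) :
    ∫ x, Ξ (x, y) * cutoffKernel ε l (x, y) ∂hf.posPart -
      ∫ x, Ξ (x, y) * cutoffKernel ε l (x, y) ∂hf.negPart +
      ∫ x, (f x : ℂ) * (fderiv ℝ Ξ (x, y) (1, 0) + Complex.I * fderiv ℝ Ξ (x, y) (0, 1)) *
        cutoffKernel ε l (x, y) = ∫ x, (f x : ℂ) * (Complex.I * cutoffDeriv Ξ ε l (x, y)) := by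
  rcases lt_or_ge ε |y| with hy | hy
  swap
  · have h0 (x : ℝ) : cutoffKernel ε l (x, y) = 0 := cutoffKernel_of_le (p := (x, y)) hy
    simp [h0, cutoffDeriv]
  have hy0 : y ≠ 0 := abs_pos.1 (hε.trans hy)
  have hk (x : ℝ) : cutoffKernel ε l (x, y) = cauchyKernel l (x, y) :=
    cutoffKernel_of_lt (p := (x, y)) hy
  have hkc : ContDiff ℝ 1 fun x => cauchyKernel l (x, y) := by
    refine ContDiff.inv (f := fun x : ℝ => (l : ℂ) - (x + Complex.I * y)) ?_
      fun x => cauchyKernel_denom_ne_zero l x hy0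
    exact contDiff_const.sub (Complex.ofRealCLM.contDiff.add contDiff_const)
  have hG : ContDiff ℝ 1 fun x => Ξ (x, y) * cauchyKernel l (x, y) :=
    ((hΞ.of_le (by exact_mod_cast le_top)).comp (contDiff_id.prodMk contDiff_const)).mul hkc
  have hGs : HasCompactSupport fun x => Ξ (x, y) * cauchyKernel l (x, y) :=
    (hΞs.comp_mk_left y).mul_right
  have hder (x : ℝ) : deriv (fun x => Ξ (x, y) * cauchyKernel l (x, y)) x =
      fderiv ℝ Ξ (x, y) (1, 0) * cauchyKernel l (x, y) + Ξ (x, y) * cauchyKernel l (x, y) ^ 2 :=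
    ((hasDerivAt_fst hΞ x y).mul (hasDerivAt_cauchyKernel_fst l x hy0)).deriv
  have hc (v : ℝ × ℝ) : Continuous fun x : ℝ => fderiv ℝ Ξ (x, y) v :=
    (continuous_fderiv_apply hΞ v).comp (by fun_prop : Continuous fun x : ℝ => (x, y))
  have hcΞ : Continuous fun x : ℝ => Ξ (x, y) := hΞ.continuous.comp (by fun_prop)
  have hi1 : Integrable fun x => (f x : ℂ) * (fderiv ℝ Ξ (x, y) (1, 0) * cauchyKernel l (x, y) +
      Ξ (x, y) * cauchyKernel l (x, y) ^ 2) := by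
    refine hf.integrable_mul (Continuous.integrable_of_hasCompactSupport ?_ ?_) measurable_id
    · exact ((hc _).mul hkc.continuous).add (hcΞ.mul (hkc.continuous.pow 2))
    · exact (((hasCompactSupport_fderiv_apply hΞs (1, 0)).comp_mk_left y).mul_right).add
        ((hΞs.comp_mk_left y).mul_right)
  have hi2 : Integrable fun x => (f x : ℂ) * ((fderiv ℝ Ξ (x, y) (1, 0) +
      Complex.I * fderiv ℝ Ξ (x, y) (0, 1)) * cauchyKernel l (x, y)) := by
    refine hf.integrable_mul (Continuous.integrable_of_hasCompactSupport ?_ ?_) measurable_id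
    · exact ((hc _).add (continuous_const.mul (hc _))).mul hkc.continuous
    · exact (((hasCompactSupport_fderiv_apply hΞs (1, 0)).comp_mk_left y).add
        (((hasCompactSupport_fderiv_apply hΞs (0, 1)).comp_mk_left y).mul_left)).mul_right
  simp only [hk, cutoffDeriv]
  rw [hf.integral_posPart_sub_integral_negPart hf_supp hG hGs]
  simp_rw [hder]
  simp_rw [mul_assoc (f _ : ℂ)]
  rw [neg_add_eq_sub, ← integral_sub hi2 hi1]
  congr 1
  ext x
  linear_combination (-(f x : ℂ) * Ξ (x, y) * cauchyKernel l (x, y) ^ 2) * Complex.I_sq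

/-- Fubini with `x` innermost allows `integral_section_eq`; exchanging the order makes the integrand
an exact `y`-derivative, leaving the values at `±ε`. -/
theorem cutoffIntegral_eq (hf : BoundedVariationOn f univ) (hf_supp : HasCompactSupport f)
    (hΞ : ContDiff ℝ ∞ Ξ) (hΞs : HasCompactSupport Ξ)
    (hΞ_one : ∀ᶠ p in 𝓝ˢ (tsupport f ×ˢ ({0} : Set ℝ)), Ξ p = 1) :
    ∃ δ > 0, ∀ ε, 0 < ε → ε < δ → ∀ l,
      cutoffIntegral hf Ξ ε l = ((2 * poissonIntegral f ε l : ℝ) : ℂ) := by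
  obtain ⟨δ, hδ, hone⟩ := eventually_eq_one_of_nhdsSet hf_supp hΞ_one
  refine ⟨δ, hδ, fun ε hε hεδ l => ?_⟩
  have hΞi (μ : Measure ℝ) [IsFiniteMeasure μ] :
      Integrable (fun p => Ξ p * cutoffKernel ε l p) (μ.prod volume) :=
    integrable_mul_cutoffKernel _ (hΞ.continuous.integrable_of_hasCompactSupport hΞs) hε l
  have hdi : Integrable (fun p : ℝ × ℝ => zetaDensity f Ξ p * cutoffKernel ε l p)
      ((volume : Measure ℝ).prod volume) :=
    integrable_mul_cutoffKernel _ (hf.integrable_density hΞ hΞs) hε l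
  have hswap : Integrable (fun p : ℝ × ℝ => (f p.1 : ℂ) * (Complex.I * cutoffDeriv Ξ ε l p))
      ((volume : Measure ℝ).prod volume) :=
    hf.integrable_mul ((integrable_cutoffDeriv hΞ hΞs hε l).const_mul _) measurable_fst
  rw [cutoffIntegral, integral_prod_symm _ (hΞi _), integral_prod_symm _ (hΞi _),
    Measure.volume_eq_prod, integral_prod_symm _ hdi,
    ← integral_sub (hΞi _).integral_prod_right (hΞi _).integral_prod_right]
  refine (integral_add ((hΞi _).integral_prod_right.sub (hΞi _).integral_prod_right)
    hdi.integral_prod_right).symm.trans ?_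
  simp only [Pi.sub_apply, zetaDensity]
  simp_rw [integral_section_eq hf hf_supp hΞ hΞs hε l]
  rw [← integral_prod_symm _ hswap, integral_prod _ hswap]
  simp_rw [integral_const_mul, integral_cutoffDeriv hΞ hΞs hε]
  -- Where `f x ≠ 0`, the choice `ε < δ` gives `Ξ = 1` at both boundary points.
  have hval (x : ℝ) : (f x : ℂ) * (Complex.I * (Ξ (x, -ε) * cauchyKernel l (x, -ε) -
      Ξ (x, ε) * cauchyKernel l (x, ε))) =
      Complex.I * ((f x : ℂ) * (((l : ℂ) - (x + Complex.I * (-ε : ℝ)))⁻¹ -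
        ((l : ℂ) - (x + Complex.I * ε))⁻¹)) := by
    rcases eq_or_ne (f x) 0 with h | h
    · simp [h]
    · have hx : x ∈ tsupport f := subset_tsupport f h
      rw [hone ε (by rwa [abs_of_pos hε]) x hx, hone (-ε) (by rwa [abs_neg, abs_of_pos hε]) x hx]
      simp only [cauchyKernel]
      ring
  simp_rw [hval]
  rw [integral_const_mul, integral_mul_inv_sub_inv_eq_poissonIntegral hε]
  push_cast
  linear_combination (-2 * (poissonIntegral f ε l : ℂ)) * Complex.I_sq

end CauchyKernel

/-! ### Integration against a complex measure with a density. -/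

section WithDensity

variable {X V : Type*} [MeasurableSpace X] [NormedAddCommGroup V] [NormedSpace ℂ V]
  {μ : Measure X} {g : X → ℂ} {F : X → V}

lemma integrable_variation_withDensityᵥ_iff (hg : Integrable g μ) :
    Integrable F (μ.withDensityᵥ g).variation ↔ Integrable (fun x => ‖g x‖₊ • F x) μ := by
  rw [Measure.variation_withDensityᵥ hg]
  exact integrable_withDensity_iff_integrable_smul₀ hg.aestronglyMeasurable.nnnorm.aemeasurable

lemma norm_nnnorm_smul (c : ℂ) (v : V) : ‖‖c‖₊ • v‖ = ‖c • v‖ := by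
  rw [NNReal.smul_def, norm_smul, norm_smul, coe_nnnorm, norm_norm]

lemma integrable_variation_withDensityᵥ (hg : Integrable g μ) (hF : AEStronglyMeasurable F μ)
    (h : Integrable (fun x => g x • F x) μ) : Integrable F (μ.withDensityᵥ g).variation := by
  rw [integrable_variation_withDensityᵥ_iff hg]
  refine h.mono (hg.aestronglyMeasurable.nnnorm.smul hF) (Eventually.of_forall fun x => ?_)
  exact (norm_nnnorm_smul _ _).le

/-- The variation is `|g| μ`, which controls `|g| F`; measurability of `g F` is recovered by
multiplying with the phase `g / |g|`. `F` itself may be non-measurable where `g = 0`. -/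
lemma Integrable.smul_of_variation_withDensityᵥ (hg : Integrable g μ)
    (h : Integrable F (μ.withDensityᵥ g).variation) : Integrable (fun x => g x • F x) μ := by
  rw [integrable_variation_withDensityᵥ_iff hg] at h
  have hm : AEStronglyMeasurable (fun x => (g x * (‖g x‖ : ℂ)⁻¹) • (‖g x‖₊ • F x)) μ := by
    have h1 := hg.aestronglyMeasurable.norm.aemeasurable
    have h2 := hg.aestronglyMeasurable.aemeasurable
    have h3 : AEMeasurable (fun x => g x * (‖g x‖ : ℂ)⁻¹) μ :=
      h2.mul (Complex.measurable_ofReal.comp_aemeasurable h1).inv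
    exact h3.aestronglyMeasurable.smul h.aestronglyMeasurable
  have he (x : X) : (g x * (‖g x‖ : ℂ)⁻¹) • (‖g x‖₊ • F x) = g x • F x := by
    rcases eq_or_ne (g x) 0 with h0 | h0
    · simp [h0]
    · have h1 : (‖g x‖ : ℂ) ≠ 0 := by simpa using h0
      have h2 : ‖g x‖₊ • F x = (‖g x‖ : ℂ) • F x := by
        rw [NNReal.smul_def, coe_nnnorm, Complex.coe_smul]
      rw [h2, smul_smul, mul_assoc, inv_mul_cancel₀ h1, mul_one]
  simp_rw [he] at hm
  exact h.mono hm (Eventually.of_forall fun x => (norm_nnnorm_smul _ _).ge)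

/-- Both sides agree on indicators and are additive and continuous for the `L¹` norm of `|g| μ`. -/
theorem complexMeasureIntegral_withDensityᵥ [CompleteSpace V] (hg : Integrable g μ)
    (hF : Integrable F (μ.withDensityᵥ g).variation) :
    complexMeasureIntegral (μ.withDensityᵥ g) F = ∫ x, g x • F x ∂μ := by
  refine Integrable.induction (fun F : X → V =>
    complexMeasureIntegral (μ.withDensityᵥ g) F = ∫ x, g x • F x ∂μ) ?_ ?_ ?_ ?_ hF
  · intro c s hs hsfin
    rw [complexMeasureIntegral, VectorMeasure.integral_eq_setToFun,
      setToFun_indicator_const _ hs hsfin.ne]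
    have h1 : (fun x => g x • s.indicator (fun _ => c) x) = s.indicator fun x => g x • c := by
      ext x
      by_cases hx : x ∈ s <;> simp [hx]
    rw [h1, integral_indicator hs, integral_smul_const, ← withDensityᵥ_apply hg hs]
    rfl
  · intro F G _ hF hG h1 h2
    have h3 : complexMeasureIntegral (μ.withDensityᵥ g) (F + G) =
        complexMeasureIntegral (μ.withDensityᵥ g) F + complexMeasureIntegral (μ.withDensityᵥ g) G :=
      VectorMeasure.integral_add hF hG
    rw [h3, h1, h2, ← integral_add (Integrable.smul_of_variation_withDensityᵥ hg hF)
      (Integrable.smul_of_variation_withDensityᵥ hg hG)]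
    simp only [Pi.add_apply, smul_add]
  · refine isClosed_eq VectorMeasure.continuous_integral ?_
    refine LipschitzWith.continuous (K := 1) (LipschitzWith.of_dist_le_mul fun F G => ?_)
    have hF := Integrable.smul_of_variation_withDensityᵥ hg (L1.integrable_coeFn F)
    have hG := Integrable.smul_of_variation_withDensityᵥ hg (L1.integrable_coeFn G)
    have h1 : dist F G = ∫ x, ‖F x - G x‖ ∂(μ.withDensityᵥ g).variation := by
      rw [dist_eq_norm, L1.norm_eq_integral_norm]
      refine integral_congr_ae ?_
      filter_upwards [Lp.coeFn_sub F G] with x hx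
      rw [hx, Pi.sub_apply]
    have h2 : ∫ x, ‖F x - G x‖ ∂(μ.withDensityᵥ g).variation =
        ∫ x, ‖g x‖₊ • ‖F x - G x‖ ∂μ :=
      (congrArg (fun m => ∫ x, ‖F x - G x‖ ∂m) (Measure.variation_withDensityᵥ hg)).trans
        (integral_withDensity_eq_integral_smul₀ hg.aestronglyMeasurable.nnnorm.aemeasurable _)
    rw [NNReal.coe_one, one_mul, h1, h2, dist_eq_norm, ← integral_sub hF hG]
    refine (norm_integral_le_integral_norm _).trans (le_of_eq ?_)
    refine integral_congr_ae (Eventually.of_forall fun x => ?_)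
    simp only [← smul_sub, norm_smul, NNReal.smul_def, smul_eq_mul, coe_nnnorm]
  · intro F G hFG _ h
    have h1 : complexMeasureIntegral (μ.withDensityᵥ g) G =
        complexMeasureIntegral (μ.withDensityᵥ g) F := VectorMeasure.integral_congr_ae hFG.symm
    rw [h1, h]
    refine integral_congr_ae ?_
    rw [Measure.variation_withDensityᵥ hg] at hFG
    -- Equality holds only almost everywhere on `g ≠ 0`, which suffices since the integrands vanish
    -- elsewhere.
    have h2 := (ae_withDensity_iff_ae_restrict' hg.aestronglyMeasurable.enorm).1 hFG
    rw [ae_restrict_iff'₀] at h2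
    · filter_upwards [h2] with x hx
      by_cases h0 : g x = 0
      · simp [h0]
      · rw [hx (by simpa using h0)]
    · exact hg.aestronglyMeasurable.enorm.nullMeasurableSet_preimage (measurableSet_singleton 0).compl

end WithDensity

/-! ### Integration against `ζ_f` and null sets of its variation. -/

section ZetaMeasure

variable {V : Type*} [NormedAddCommGroup V] [NormedSpace ℂ V] {f : ℝ → ℝ} {Ξ : ℝ × ℝ → ℂ}

lemma integrable_prod_of_hasCompactSupport (hΞ : ContDiff ℝ ∞ Ξ) (hΞs : HasCompactSupport Ξ)
    (μ : Measure ℝ) [IsFiniteMeasure μ] : Integrable Ξ (μ.prod volume) :=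
  hΞ.continuous.integrable_of_hasCompactSupport hΞs

/-- Integrability is required for each piece, since the pieces may cancel in `ζ_f`. This costs
nothing for the bounded cut off resolvents. -/
theorem complexMeasureIntegral_zetaMeasure [CompleteSpace V] (hf : BoundedVariationOn f univ)
    (hΞ : ContDiff ℝ ∞ Ξ) (hΞs : HasCompactSupport Ξ) {F : ℝ × ℝ → V}
    (h1 : Integrable F ((hf.posPart.prod volume).withDensityᵥ Ξ).variation)
    (h2 : Integrable F ((hf.negPart.prod volume).withDensityᵥ Ξ).variation)
    (h3 : Integrable F ((volume : Measure (ℝ × ℝ)).withDensityᵥ (zetaDensity f Ξ)).variation) :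
    complexMeasureIntegral (zetaMeasure hf Ξ) F =
      ∫ p, Ξ p • F p ∂(hf.posPart.prod volume) - ∫ p, Ξ p • F p ∂(hf.negPart.prod volume) +
        ∫ p, zetaDensity f Ξ p • F p := by
  rw [← complexMeasureIntegral_withDensityᵥ (integrable_prod_of_hasCompactSupport hΞ hΞs _) h1,
    ← complexMeasureIntegral_withDensityᵥ (integrable_prod_of_hasCompactSupport hΞ hΞs _) h2,
    ← complexMeasureIntegral_withDensityᵥ (hf.integrable_density hΞ hΞs) h3]
  exact (VectorMeasure.integral_add_vectorMeasure
    (VectorMeasure.Integrable.sub_vectorMeasure h1 h2) h3).trans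
    (congrArg (· + _) (VectorMeasure.integral_sub_vectorMeasure h1 h2))

lemma integrable_variation_of_bound {X : Type*} [MeasurableSpace X] {μ : Measure X} {g : X → ℂ}
    {F : X → V} (hg : Integrable g μ) (hF : AEStronglyMeasurable F μ) {C : ℝ}
    (hC : ∀ x, ‖F x‖ ≤ C) : Integrable F (μ.withDensityᵥ g).variation := by
  refine integrable_variation_withDensityᵥ hg hF ?_
  refine (hg.norm.mul_const C).mono (hg.aestronglyMeasurable.smul hF)
    (Eventually.of_forall fun x => ?_)
  rw [norm_smul, norm_mul, norm_norm]
  exact mul_le_mul_of_nonneg_left ((hC x).trans (le_abs_self C)) (norm_nonneg _)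

lemma variation_zetaMeasure_le (hf : BoundedVariationOn f univ) :
    (zetaMeasure hf Ξ).variation ≤ ((hf.posPart.prod volume).withDensityᵥ Ξ).variation +
      ((hf.negPart.prod volume).withDensityᵥ Ξ).variation +
      ((volume : Measure (ℝ × ℝ)).withDensityᵥ (zetaDensity f Ξ)).variation :=
  VectorMeasure.variation_add_le.trans (add_le_add_left VectorMeasure.variation_sub_le _)

lemma variation_withDensityᵥ_eq_zero {X : Type*} [MeasurableSpace X] {μ : Measure X} {g : X → ℂ}
    (hg : Integrable g μ) {s : Set X} (hs : μ s = 0) : (μ.withDensityᵥ g).variation s = 0 := by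
  rw [Measure.variation_withDensityᵥ hg]
  exact withDensity_absolutelyContinuous _ _ hs

/-- The line `y = 0` is a null set for `|ζ_f|`. -/
lemma ae_variation_zetaMeasure_snd_ne_zero (hf : BoundedVariationOn f univ)
    (hΞ : ContDiff ℝ ∞ Ξ) (hΞs : HasCompactSupport Ξ) :
    ∀ᵐ p ∂(zetaMeasure hf Ξ).variation, p.2 ≠ 0 := by
  have hs : {p : ℝ × ℝ | ¬ p.2 ≠ 0} = univ ×ˢ {0} := by
    ext p; simp
  have h0 (μ : Measure ℝ) : (μ.prod (volume : Measure ℝ)) {p : ℝ × ℝ | ¬ p.2 ≠ 0} = 0 := by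
    rw [hs, Measure.prod_prod]
    simp
  rw [ae_iff]
  refine le_antisymm ((variation_zetaMeasure_le hf _).trans (le_of_eq ?_)) bot_le
  rw [Measure.add_apply, Measure.add_apply,
    variation_withDensityᵥ_eq_zero (integrable_prod_of_hasCompactSupport hΞ hΞs _) (h0 _),
    variation_withDensityᵥ_eq_zero (integrable_prod_of_hasCompactSupport hΞ hΞs _) (h0 _),
    variation_withDensityᵥ_eq_zero (hf.integrable_density hΞ hΞs)
      (by rw [Measure.volume_eq_prod]; exact h0 _)]
  simp

end ZetaMeasure

/-! ### Exchanging integrals for bounded kernels. -/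

section Fubini

variable {X Y : Type*} [MeasurableSpace X] [MeasurableSpace Y] {μ : Measure X} {ν : Measure Y}
  [SFinite μ] [IsFiniteMeasure ν] {g : X → ℂ} {k : Y → X → ℂ}

lemma integrable_mul_kernel_prod (hg : Integrable g μ) (hk : Measurable (Function.uncurry k)) {C : ℝ}
    (hC : ∀ y x, ‖k y x‖ ≤ C) : Integrable (fun q : Y × X => g q.2 * k q.1 q.2) (ν.prod μ) :=
  (hg.comp_snd ν).mul_bdd (c := C) hk.aestronglyMeasurable (Eventually.of_forall fun q => hC q.1 q.2)

lemma integral_integral_mul_kernel (hg : Integrable g μ) (hk : Measurable (Function.uncurry k))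
    {C : ℝ} (hC : ∀ y x, ‖k y x‖ ≤ C) :
    ∫ y, ∫ x, g x * k y x ∂μ ∂ν = ∫ x, g x * ∫ y, k y x ∂ν ∂μ := by
  have h := integral_integral_swap (f := fun y x => g x * k y x)
    (integrable_mul_kernel_prod (ν := ν) hg hk hC)
  rw [h]
  simp_rw [integral_const_mul]

end Fubini

lemma measurable_uncurry_cutoffKernel (ε : ℝ) :
    Measurable (Function.uncurry (cutoffKernel ε)) := by
  have h : Function.uncurry (cutoffKernel ε) = {q : ℝ × ℝ × ℝ | ε < |q.2.2|}.indicator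
      (fun q => ((q.1 : ℂ) - (q.2.1 + Complex.I * q.2.2))⁻¹) := by
    ext q
    rfl
  rw [h]
  exact Measurable.indicator (by fun_prop) (measurableSet_lt measurable_const (by fun_prop))

/-! ### The cut off resolvent integral and its two limits. -/

section CutoffResolvent

variable {H : Type*} [NormedAddCommGroup H] [InnerProductSpace ℂ H]
  {K : H →ₗ.[ℂ] H}

/-- The resolvent `R_{x + iy}(K)`, cut off at `|y| ≤ ε`. -/
noncomputable def cutoffResolvent (K : H →ₗ.[ℂ] H) (ε : ℝ) : ℝ × ℝ → H →L[ℂ] H :=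
  {p : ℝ × ℝ | ε < |p.2|}.indicator fun p => resolventOp K (p.1 + Complex.I * p.2)

lemma cutoffResolvent_of_lt {ε : ℝ} {p : ℝ × ℝ} (h : ε < |p.2|) :
    cutoffResolvent K ε p = resolventOp K (p.1 + Complex.I * p.2) :=
  indicator_of_mem (s := {p : ℝ × ℝ | ε < |p.2|}) h _

lemma cutoffResolvent_of_le {ε : ℝ} {p : ℝ × ℝ} (h : |p.2| ≤ ε) : cutoffResolvent K ε p = 0 :=
  indicator_of_notMem (s := {p : ℝ × ℝ | ε < |p.2|}) (not_lt.2 h) _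

variable [CompleteSpace H]

lemma im_add_I_mul (p : ℝ × ℝ) : ((p.1 : ℂ) + Complex.I * p.2).im = p.2 := by simp

lemma IsSelfAdjoint.aestronglyMeasurable_indicator_resolventOp (hK : IsSelfAdjoint K)
    {s : Set (ℝ × ℝ)} (hs : MeasurableSet s) (hs0 : ∀ p ∈ s, p.2 ≠ 0) (μ : Measure (ℝ × ℝ)) :
    AEStronglyMeasurable (s.indicator fun p => resolventOp K (p.1 + Complex.I * p.2)) μ := by
  rw [aestronglyMeasurable_indicator_iff hs]
  refine ContinuousOn.aestronglyMeasurable ?_ hs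
  refine hK.continuousOn_resolventOp.comp (by fun_prop) fun p hp => ?_
  change ((p.1 : ℂ) + Complex.I * p.2).im ≠ 0
  rw [im_add_I_mul]
  exact hs0 p hp

lemma IsSelfAdjoint.aestronglyMeasurable_cutoffResolvent (hK : IsSelfAdjoint K) {ε : ℝ}
    (hε : 0 < ε) (μ : Measure (ℝ × ℝ)) : AEStronglyMeasurable (cutoffResolvent K ε) μ :=
  hK.aestronglyMeasurable_indicator_resolventOp (measurableSet_lt_abs_snd ε)
    (fun _ hp => abs_pos.1 (hε.trans hp)) μ

lemma IsSelfAdjoint.norm_cutoffResolvent_le (hK : IsSelfAdjoint K) {ε : ℝ} (hε : 0 < ε)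
    (p : ℝ × ℝ) : ‖cutoffResolvent K ε p‖ ≤ ε⁻¹ := by
  rcases lt_or_ge ε |p.2| with h | h
  · rw [cutoffResolvent_of_lt h]
    have h0 : ((p.1 : ℂ) + Complex.I * p.2).im ≠ 0 := by
      rw [im_add_I_mul]; exact abs_pos.1 (hε.trans h)
    refine (hK.norm_resolventOp_le h0).trans ?_
    rw [im_add_I_mul]
    exact inv_anti₀ hε h.le
  · rw [cutoffResolvent_of_le h, norm_zero]
    positivity

variable {E : ProjectionValuedMeasure H}

lemma ProjectionValuedMeasure.IsSpectralMeasureOf.inner_cutoffResolvent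
    (hE : E.IsSpectralMeasureOf K) (hK : IsSelfAdjoint K) {ε : ℝ} (hε : 0 < ε) (p : ℝ × ℝ) (ψ : H) :
    inner ℂ ψ (cutoffResolvent K ε p ψ) = ∫ l, cutoffKernel ε l p ∂(E.measure ψ) := by
  rcases lt_or_ge ε |p.2| with h | h
  · have h0 : ((p.1 : ℂ) + Complex.I * p.2).im ≠ 0 := by
      rw [im_add_I_mul]; exact abs_pos.1 (hε.trans h)
    rw [cutoffResolvent_of_lt h, (hE.isIntegral_resolventOp hK h0 ψ).2]
    simp_rw [cutoffKernel_of_lt h, cauchyKernel]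
  · simp_rw [cutoffResolvent_of_le h, cutoffKernel_of_le h]
    simp

variable {f : ℝ → ℝ} {Ξ : ℝ × ℝ → ℂ}

/-- The operator `∫ dζ_f(x, y) R_{x + iy}(K)`, cut off at `|y| ≤ ε`. -/
noncomputable def cutoffOperator (hf : BoundedVariationOn f univ) (Ξ : ℝ × ℝ → ℂ)
    (K : H →ₗ.[ℂ] H) (ε : ℝ) : H →L[ℂ] H :=
  complexMeasureIntegral (zetaMeasure hf Ξ) (cutoffResolvent K ε)

lemma integrable_smul_of_bound {X V : Type*} [MeasurableSpace X] [NormedAddCommGroup V]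
    [NormedSpace ℂ V] {μ : Measure X} {g : X → ℂ} {F : X → V} (hg : Integrable g μ)
    (hF : AEStronglyMeasurable F μ) {C : ℝ} (hC : ∀ x, ‖F x‖ ≤ C) :
    Integrable (fun x => g x • F x) μ :=
  Integrable.smul_of_variation_withDensityᵥ hg (integrable_variation_of_bound hg hF hC)

lemma ProjectionValuedMeasure.IsSpectralMeasureOf.inner_integral_smul_cutoffResolvent
    (hE : E.IsSpectralMeasureOf K) (hK : IsSelfAdjoint K) {ε : ℝ} (hε : 0 < ε)
    {μ : Measure (ℝ × ℝ)} [SFinite μ] {g : ℝ × ℝ → ℂ} (hg : Integrable g μ) (ψ : H) :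
    Integrable (fun l => ∫ p, g p * cutoffKernel ε l p ∂μ) (E.measure ψ) ∧
      inner ℂ ψ ((∫ p, g p • cutoffResolvent K ε p ∂μ) ψ) =
        ∫ l, ∫ p, g p * cutoffKernel ε l p ∂μ ∂(E.measure ψ) := by
  have hk := measurable_uncurry_cutoffKernel ε
  have hC := norm_cutoffKernel_le hε
  refine ⟨(integrable_mul_kernel_prod hg hk hC).integral_prod_left, ?_⟩
  rw [integral_integral_mul_kernel hg hk hC]
  have hi : Integrable (fun p => g p • cutoffResolvent K ε p) μ :=
    integrable_smul_of_bound hg (hK.aestronglyMeasurable_cutoffResolvent hε μ)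
      (hK.norm_cutoffResolvent_le hε)
  have h1 := ((innerSL ℂ ψ).comp (ContinuousLinearMap.apply ℂ H ψ)).integral_comp_comm hi
  refine h1.symm.trans (integral_congr_ae (Eventually.of_forall fun p => ?_))
  change inner ℂ ψ (g p • cutoffResolvent K ε p ψ) = _
  rw [inner_smul_right, hE.inner_cutoffResolvent hK hε]

lemma IsSelfAdjoint.integrable_variation_clm_cutoffResolvent {V : Type*} [NormedAddCommGroup V]
    [NormedSpace ℂ V] (hK : IsSelfAdjoint K) {ε : ℝ} (hε : 0 < ε) (L : (H →L[ℂ] H) →L[ℂ] V)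
    {μ : Measure (ℝ × ℝ)} {g : ℝ × ℝ → ℂ} (hg : Integrable g μ) :
    Integrable (fun p => L (cutoffResolvent K ε p)) (μ.withDensityᵥ g).variation :=
  integrable_variation_of_bound hg
    (L.continuous.comp_aestronglyMeasurable (hK.aestronglyMeasurable_cutoffResolvent hε μ))
    fun p => (L.le_opNorm _).trans
      (mul_le_mul_of_nonneg_left (hK.norm_cutoffResolvent_le hε p) (norm_nonneg L))

/-- A general `L` covers both the identity and `sandwich A B`, so that `A` and `B` can be pulled out
of the integral. -/
lemma complexMeasureIntegral_clm_cutoffResolvent {V : Type*} [NormedAddCommGroup V]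
    [NormedSpace ℂ V] [CompleteSpace V] (hf : BoundedVariationOn f univ) (hΞ : ContDiff ℝ ∞ Ξ)
    (hΞs : HasCompactSupport Ξ) (hK : IsSelfAdjoint K) {ε : ℝ} (hε : 0 < ε)
    (L : (H →L[ℂ] H) →L[ℂ] V) :
    complexMeasureIntegral (zetaMeasure hf Ξ) (fun p => L (cutoffResolvent K ε p)) =
      L (∫ p, Ξ p • cutoffResolvent K ε p ∂(hf.posPart.prod volume) -
        ∫ p, Ξ p • cutoffResolvent K ε p ∂(hf.negPart.prod volume) +
        ∫ p, zetaDensity f Ξ p • cutoffResolvent K ε p) := by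
  have hp (μ : Measure ℝ) [IsFiniteMeasure μ] := integrable_prod_of_hasCompactSupport hΞ hΞs μ
  have hd := hf.integrable_density hΞ hΞs
  rw [complexMeasureIntegral_zetaMeasure hf hΞ hΞs
    (hK.integrable_variation_clm_cutoffResolvent hε L (hp _))
    (hK.integrable_variation_clm_cutoffResolvent hε L (hp _))
    (hK.integrable_variation_clm_cutoffResolvent hε L hd), map_add, map_sub]
  have hL {μ : Measure (ℝ × ℝ)} {g : ℝ × ℝ → ℂ} (hg : Integrable g μ) :
      L (∫ p, g p • cutoffResolvent K ε p ∂μ) = ∫ p, g p • L (cutoffResolvent K ε p) ∂μ := by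
    have hi : Integrable (fun p => g p • cutoffResolvent K ε p) μ :=
      integrable_smul_of_bound hg (hK.aestronglyMeasurable_cutoffResolvent hε μ)
        (hK.norm_cutoffResolvent_le hε)
    rw [← L.integral_comp_comm hi]
    simp_rw [map_smul]
  rw [hL (hp _), hL (hp _), hL hd]

lemma cutoffOperator_eq (hf : BoundedVariationOn f univ) (hΞ : ContDiff ℝ ∞ Ξ)
    (hΞs : HasCompactSupport Ξ) (hK : IsSelfAdjoint K) {ε : ℝ} (hε : 0 < ε) :
    cutoffOperator hf Ξ K ε = ∫ p, Ξ p • cutoffResolvent K ε p ∂(hf.posPart.prod volume) -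
        ∫ p, Ξ p • cutoffResolvent K ε p ∂(hf.negPart.prod volume) +
        ∫ p, zetaDensity f Ξ p • cutoffResolvent K ε p :=
  complexMeasureIntegral_clm_cutoffResolvent hf hΞ hΞs hK hε (ContinuousLinearMap.id ℂ _)

/-- Multiplication by `A` from the left and by `B` from the right. -/
noncomputable def sandwich (A B : H →L[ℂ] H) : (H →L[ℂ] H) →L[ℂ] H →L[ℂ] H :=
  (ContinuousLinearMap.mul ℂ (H →L[ℂ] H) A).comp ((ContinuousLinearMap.mul ℂ (H →L[ℂ] H)).flip B)

lemma complexMeasureIntegral_sandwich_cutoffResolvent (hf : BoundedVariationOn f univ)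
    (hΞ : ContDiff ℝ ∞ Ξ) (hΞs : HasCompactSupport Ξ) (hK : IsSelfAdjoint K) {ε : ℝ} (hε : 0 < ε)
    (A B : H →L[ℂ] H) :
    complexMeasureIntegral (zetaMeasure hf Ξ) (fun p => A ∘L cutoffResolvent K ε p ∘L B) =
      A ∘L cutoffOperator hf Ξ K ε ∘L B := by
  rw [cutoffOperator_eq hf hΞ hΞs hK hε]
  exact complexMeasureIntegral_clm_cutoffResolvent hf hΞ hΞs hK hε (sandwich A B)

theorem ProjectionValuedMeasure.IsSpectralMeasureOf.isIntegral_cutoffOperator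
    (hE : E.IsSpectralMeasureOf K) (hK : IsSelfAdjoint K) (hf : BoundedVariationOn f univ)
    (hΞ : ContDiff ℝ ∞ Ξ) (hΞs : HasCompactSupport Ξ) {ε : ℝ} (hε : 0 < ε) :
    E.IsIntegral (cutoffIntegral hf Ξ ε) (cutoffOperator hf Ξ K ε) := by
  intro ψ
  have h1 := hE.inner_integral_smul_cutoffResolvent hK hε
    (integrable_prod_of_hasCompactSupport hΞ hΞs hf.posPart) ψ
  have h2 := hE.inner_integral_smul_cutoffResolvent hK hε
    (integrable_prod_of_hasCompactSupport hΞ hΞs hf.negPart) ψ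
  have h3 := hE.inner_integral_smul_cutoffResolvent hK hε (hf.integrable_density hΞ hΞs) ψ
  refine ⟨(h1.1.sub h2.1).add h3.1, ?_⟩
  rw [cutoffOperator_eq hf hΞ hΞs hK hε, _root_.add_apply, _root_.sub_apply, inner_add_right,
    inner_sub_right, h1.2, h2.2, h3.2, ← integral_sub h1.1 h2.1]
  exact (integral_add (h1.1.sub h2.1) h3.1).symm

/-- The cut off integrals of the resolvent converge weakly to `2π` times the function
`(f(x+) + f(x-)) / 2` of `K`. -/
theorem ProjectionValuedMeasure.IsSpectralMeasureOf.tendsto_inner_cutoffOperator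
    (hE : E.IsSpectralMeasureOf K) (hK : IsSelfAdjoint K) (hf : BoundedVariationOn f univ)
    (hf_supp : HasCompactSupport f) (hΞ : ContDiff ℝ ∞ Ξ) (hΞs : HasCompactSupport Ξ)
    (hΞ_one : ∀ᶠ p in 𝓝ˢ (tsupport f ×ˢ ({0} : Set ℝ)), Ξ p = 1) {T : H →L[ℂ] H}
    (hT : E.IsIntegral (fun l => (limAverage f l : ℂ)) T) (φ ψ : H) :
    Tendsto (fun ε => inner ℂ φ (cutoffOperator hf Ξ K ε ψ)) (𝓝[>] 0)
      (𝓝 (inner ℂ φ (((2 * Real.pi : ℂ) • T) ψ))) := by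
  refine tendsto_inner_apply_of_tendsto_inner_self (fun ψ => ?_) φ ψ
  obtain ⟨δ, hδ, hcut⟩ := cutoffIntegral_eq hf hf_supp hΞ hΞs hΞ_one
  obtain ⟨M, hM⟩ := hf.exists_abs_le
  have hev : ∀ᶠ ε in 𝓝[>] (0 : ℝ), 0 < ε ∧ ε < δ := Ioo_mem_nhdsGT hδ
  have hlim : inner ℂ ψ (((2 * Real.pi : ℂ) • T) ψ) =
      ∫ l, ((2 * (Real.pi * limAverage f l) : ℝ) : ℂ) ∂(E.measure ψ) := by
    rw [_root_.smul_apply, inner_smul_right, (hT ψ).2, ← integral_const_mul]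
    congr 1
    ext l
    push_cast
    ring
  rw [hlim]
  have heq : (fun ε => inner ℂ ψ (cutoffOperator hf Ξ K ε ψ)) =ᶠ[𝓝[>] 0]
      fun ε => ∫ l, cutoffIntegral hf Ξ ε l ∂(E.measure ψ) := by
    filter_upwards [hev] with ε hε
    exact (hE.isIntegral_cutoffOperator hK hf hΞ hΞs hε.1 ψ).2
  refine (tendsto_congr' heq).2 ?_
  -- The kernel bound `ε⁻¹` blows up; the uniform bound comes from the Poisson form of the cut off
  -- integral.
  refine tendsto_integral_filter_of_dominated_convergence (fun _ => 2 * (M * Real.pi)) ?_ ?_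
    (integrable_const _) ?_
  · filter_upwards [hev] with ε hε
    exact (hE.isIntegral_cutoffOperator hK hf hΞ hΞs hε.1 ψ).1.aestronglyMeasurable
  · filter_upwards [hev] with ε hε
    refine Eventually.of_forall fun l => ?_
    rw [hcut ε hε.1 hε.2 l, Complex.norm_real, Real.norm_eq_abs, abs_mul, abs_two]
    exact mul_le_mul_of_nonneg_left (abs_poissonIntegral_le hM ε l) zero_le_two
  · refine Eventually.of_forall fun l => ?_
    have h1 : Tendsto (fun ε => ((2 * poissonIntegral f ε l : ℝ) : ℂ)) (𝓝[>] 0)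
        (𝓝 ((2 * (Real.pi * limAverage f l) : ℝ) : ℂ)) :=
      (Complex.continuous_ofReal.tendsto _).comp ((hf.tendsto_poissonIntegral l).const_mul 2)
    refine h1.congr' ?_
    filter_upwards [hev] with ε hε
    exact (hcut ε hε.1 hε.2 l).symm

variable {A B : H →L[ℂ] H}

lemma integrable_comp_resolventOp_comp (hf : BoundedVariationOn f univ) (hΞ : ContDiff ℝ ∞ Ξ)
    (hΞs : HasCompactSupport Ξ) (hK : IsSelfAdjoint K)
    (hfin : ∫⁻ p, ‖A ∘L resolventOp K (p.1 + Complex.I * p.2) ∘L B‖ₑ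
      ∂(zetaMeasure hf Ξ).variation < ⊤) :
    Integrable (fun p : ℝ × ℝ => A ∘L resolventOp K (p.1 + Complex.I * p.2) ∘L B)
      (zetaMeasure hf Ξ).variation := by
  refine ⟨?_, hfin⟩
  have h := (sandwich A B).continuous.comp_aestronglyMeasurable
    (hK.aestronglyMeasurable_indicator_resolventOp (s := {p : ℝ × ℝ | p.2 ≠ 0})
      (measurable_snd (measurableSet_singleton (0 : ℝ)).compl) (fun _ hp => hp)
      (zetaMeasure hf Ξ).variation)
  refine h.congr ?_
  filter_upwards [ae_variation_zetaMeasure_snd_ne_zero hf hΞ hΞs] with p hp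
  rw [indicator_of_mem (s := {p : ℝ × ℝ | p.2 ≠ 0}) hp]
  rfl

/-- Dominated convergence for `|ζ_f|`: the cut off functions are bounded by the full integrand and
equal it for small `ε` off the null line `y = 0`. -/
lemma tendsto_complexMeasureIntegral_cutoffResolvent (hf : BoundedVariationOn f univ)
    (hΞ : ContDiff ℝ ∞ Ξ) (hΞs : HasCompactSupport Ξ) (hK : IsSelfAdjoint K)
    (hint : Integrable (fun p : ℝ × ℝ => A ∘L resolventOp K (p.1 + Complex.I * p.2) ∘L B)
      (zetaMeasure hf Ξ).variation) :
    Tendsto (fun ε => A ∘L cutoffOperator hf Ξ K ε ∘L B) (𝓝[>] 0)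
      (𝓝 (complexMeasureIntegral (zetaMeasure hf Ξ)
        fun p : ℝ × ℝ => A ∘L resolventOp K (p.1 + Complex.I * p.2) ∘L B)) := by
  have heq : (fun ε => complexMeasureIntegral (zetaMeasure hf Ξ)
      fun p => A ∘L cutoffResolvent K ε p ∘L B) =ᶠ[𝓝[>] 0]
      fun ε => A ∘L cutoffOperator hf Ξ K ε ∘L B := by
    filter_upwards [self_mem_nhdsWithin] with ε hε
    exact complexMeasureIntegral_sandwich_cutoffResolvent hf hΞ hΞs hK hε A B
  refine (tendsto_congr' heq).1 ?_
  refine VectorMeasure.tendsto_integral_filter_of_dominated_convergence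
    (fun p => ‖A ∘L resolventOp K (p.1 + Complex.I * p.2) ∘L B‖) ?_ ?_ hint.norm ?_
  · filter_upwards [self_mem_nhdsWithin] with ε hε
    exact (sandwich A B).continuous.comp_aestronglyMeasurable
      (hK.aestronglyMeasurable_cutoffResolvent hε _)
  · refine Eventually.of_forall fun ε => Eventually.of_forall fun p => ?_
    rcases lt_or_ge ε |p.2| with h | h
    · rw [cutoffResolvent_of_lt h]
    · rw [cutoffResolvent_of_le h]
      simp
  · filter_upwards [ae_variation_zetaMeasure_snd_ne_zero hf hΞ hΞs] with p hp
    refine tendsto_const_nhds.congr' ?_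
    filter_upwards [Ioo_mem_nhdsGT (abs_pos.2 hp)] with ε hε
    rw [cutoffResolvent_of_lt hε.2]

/-- The operators `A (cutoffOperator) B` have a norm limit by integrability and a weak limit by the
spectral theorem; the two coincide. -/
theorem ProjectionValuedMeasure.IsSpectralMeasureOf.comp_limAverage_comp_eq
    (hE : E.IsSpectralMeasureOf K) (hK : IsSelfAdjoint K) (hf : BoundedVariationOn f univ)
    (hf_supp : HasCompactSupport f) (hΞ : ContDiff ℝ ∞ Ξ) (hΞs : HasCompactSupport Ξ)
    (hΞ_one : ∀ᶠ p in 𝓝ˢ (tsupport f ×ˢ ({0} : Set ℝ)), Ξ p = 1) {T : H →L[ℂ] H}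
    (hT : E.IsIntegral (fun l => (limAverage f l : ℂ)) T)
    (hint : Integrable (fun p : ℝ × ℝ => A ∘L resolventOp K (p.1 + Complex.I * p.2) ∘L B)
      (zetaMeasure hf Ξ).variation) :
    A ∘L T ∘L B = (1 / (2 * Real.pi) : ℂ) • complexMeasureIntegral (zetaMeasure hf Ξ)
      (fun p : ℝ × ℝ => A ∘L resolventOp K (p.1 + Complex.I * p.2) ∘L B) := by
  have hpi : (2 * Real.pi : ℂ) ≠ 0 := by simp [Real.pi_ne_zero]
  have h : A ∘L ((2 * Real.pi : ℂ) • T) ∘L B = complexMeasureIntegral (zetaMeasure hf Ξ)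
      (fun p : ℝ × ℝ => A ∘L resolventOp K (p.1 + Complex.I * p.2) ∘L B) := by
    refine ContinuousLinearMap.ext fun ψ => ext_inner_left ℂ fun φ => ?_
    have h1 := ((innerSL ℂ φ).comp (ContinuousLinearMap.apply ℂ H ψ)).continuous.tendsto _ |>.comp
      (tendsto_complexMeasureIntegral_cutoffResolvent hf hΞ hΞs hK hint)
    have h2 := hE.tendsto_inner_cutoffOperator hK hf hf_supp hΞ hΞs hΞ_one hT
      (ContinuousLinearMap.adjoint A φ) (B ψ)
    simp_rw [ContinuousLinearMap.adjoint_inner_left] at h2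
    exact tendsto_nhds_unique h2 h1
  rw [← h, ContinuousLinearMap.smul_comp, ContinuousLinearMap.comp_smul, smul_smul, one_div,
    inv_mul_cancel₀ hpi, one_smul]

end CutoffResolvent

/-! ### Jumps of `f` and eigenvalues of `K`. -/

section Jump

variable {f : ℝ → ℝ} {Ξ : ℝ × ℝ → ℂ}

lemma BoundedVariationOn.measureReal_posPart_sub_negPart_singleton
    (hf : BoundedVariationOn f univ) (x : ℝ) :
    hf.posPart.real {x} - hf.negPart.real {x} = Function.rightLim f x - Function.leftLim f x := by
  rw [← hf.vectorMeasure_singleton]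
  have h := SignedMeasure.toSignedMeasure_toJordanDecomposition hf.vectorMeasure
  rw [JordanDecomposition.toSignedMeasure] at h
  rw [← h, _root_.sub_apply, Measure.toSignedMeasure_apply_measurable (measurableSet_singleton x),
    Measure.toSignedMeasure_apply_measurable (measurableSet_singleton x)]

lemma withDensityᵥ_singleton_prod (hΞ : ContDiff ℝ ∞ Ξ) (hΞs : HasCompactSupport Ξ)
    (μ : Measure ℝ) [IsFiniteMeasure μ] {x : ℝ} {s : Set ℝ} (hs : MeasurableSet s)
    (h1 : ∀ y ∈ s, Ξ (x, y) = 1) :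
    (μ.prod volume).withDensityᵥ Ξ ({x} ×ˢ s) = ((μ.real {x} * volume.real s : ℝ) : ℂ) := by
  have hm : MeasurableSet (({x} : Set ℝ) ×ˢ s) := (measurableSet_singleton x).prod hs
  have hone : ∀ p ∈ ({x} : Set ℝ) ×ˢ s, Ξ p = 1 := by
    rintro ⟨a, y⟩ ⟨rfl, hy⟩
    exact h1 y hy
  rw [withDensityᵥ_apply (integrable_prod_of_hasCompactSupport hΞ hΞs μ) hm,
    setIntegral_congr_fun hm hone, setIntegral_const, measureReal_prod_prod]
  simp

/-- A vertical segment is null for planar Lebesgue measure, so only the atom of `df` at `x`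
contributes. -/
lemma zetaMeasure_singleton_prod (hf : BoundedVariationOn f univ) (hΞ : ContDiff ℝ ∞ Ξ)
    (hΞs : HasCompactSupport Ξ) {x : ℝ} {s : Set ℝ} (hs : MeasurableSet s)
    (h1 : ∀ y ∈ s, Ξ (x, y) = 1) : zetaMeasure hf Ξ ({x} ×ˢ s) =
      (((Function.rightLim f x - Function.leftLim f x) * volume.real s : ℝ) : ℂ) := by
  have h0 : (volume : Measure (ℝ × ℝ)) ({x} ×ˢ s) = 0 := by
    rw [Measure.volume_eq_prod, Measure.prod_prod]
    simp
  have h2 : (volume : Measure (ℝ × ℝ)).withDensityᵥ (zetaDensity f Ξ) ({x} ×ˢ s) = 0 := by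
    rw [withDensityᵥ_apply (hf.integrable_density hΞ hΞs) ((measurableSet_singleton x).prod hs),
      setIntegral_measure_zero _ h0]
  have h3 : zetaMeasure hf Ξ ({x} ×ˢ s) =
      (hf.posPart.prod volume).withDensityᵥ Ξ ({x} ×ˢ s) -
      (hf.negPart.prod volume).withDensityᵥ Ξ ({x} ×ˢ s) +
      (volume : Measure (ℝ × ℝ)).withDensityᵥ (zetaDensity f Ξ) ({x} ×ˢ s) := rfl
  rw [h3, h2, withDensityᵥ_singleton_prod hΞ hΞs _ hs h1,
    withDensityᵥ_singleton_prod hΞ hΞs _ hs h1,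
    ← hf.measureReal_posPart_sub_negPart_singleton]
  push_cast
  ring

/-- The variation of a set is at least `|ζ_f|` evaluated as the modulus of `ζ_f` on its part in the
segment. Integrability for the variation therefore restricts to the segment. -/
lemma smul_map_le_variation_zetaMeasure (hf : BoundedVariationOn f univ) (hΞ : ContDiff ℝ ∞ Ξ)
    (hΞs : HasCompactSupport Ξ) {x δ : ℝ} (h1 : ∀ y, |y| < δ → Ξ (x, y) = 1) :
    ‖Function.rightLim f x - Function.leftLim f x‖ₑ •
      (volume.restrict (Ioo 0 δ)).map (fun y => (x, y)) ≤ (zetaMeasure hf Ξ).variation := by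
  have hmk : Measurable fun y : ℝ => (x, y) := measurable_prodMk_left
  refine Measure.le_iff.2 fun T hT => ?_
  let s : Set ℝ := (fun y => (x, y)) ⁻¹' T ∩ Ioo 0 δ
  have hs : MeasurableSet s := (hmk hT).inter measurableSet_Ioo
  have hsfin : volume s ≠ ⊤ := measure_ne_top_of_subset inter_subset_right (by simp)
  have hsub : ({x} : Set ℝ) ×ˢ s ⊆ T := by
    rintro ⟨a, y⟩ ⟨rfl, hy⟩
    exact hy.1
  have h2 := zetaMeasure_singleton_prod hf hΞ hΞs hs
    (fun y hy => h1 y (by rw [abs_of_pos hy.2.1]; exact hy.2.2))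
  refine le_trans ?_ (((zetaMeasure hf Ξ).enorm_measure_le_variation ({x} ×ˢ s)).trans
    (measure_mono hsub))
  rw [h2, Measure.smul_apply, Measure.map_apply hmk hT, Measure.restrict_apply (hmk hT),
    smul_eq_mul]
  refine le_of_eq ?_
  rw [← ofReal_norm (_ : ℂ), Complex.norm_real, norm_mul, ENNReal.ofReal_mul (norm_nonneg _),
    ofReal_norm, Real.norm_of_nonneg measureReal_nonneg, measureReal_def,
    ENNReal.ofReal_toReal hsfin]

lemma mem_tsupport_of_not_continuousAt {x : ℝ} (hx : ¬ ContinuousAt f x) : x ∈ tsupport f := by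
  by_contra h
  exact hx ((continuousAt_const (y := (0 : ℝ))).congr
    (notMem_tsupport_iff_eventuallyEq.1 h).symm)

variable {H : Type*} [NormedAddCommGroup H] [InnerProductSpace ℂ H] [CompleteSpace H]
  {K : H →ₗ.[ℂ] H} {E : ProjectionValuedMeasure H} {A B : H →L[ℂ] H}

lemma integrableOn_resolventOp_vertical (hf : BoundedVariationOn f univ) (hΞ : ContDiff ℝ ∞ Ξ)
    (hΞs : HasCompactSupport Ξ) {x δ : ℝ} (h1 : ∀ y, |y| < δ → Ξ (x, y) = 1)
    (hx : Function.leftLim f x ≠ Function.rightLim f x)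
    (hint : Integrable (fun p : ℝ × ℝ => A ∘L resolventOp K (p.1 + Complex.I * p.2) ∘L B)
      (zetaMeasure hf Ξ).variation) :
    IntegrableOn (fun y : ℝ => A ∘L resolventOp K (x + Complex.I * y) ∘L B) (Ioo 0 δ) := by
  have h2 := hint.mono_measure (smul_map_le_variation_zetaMeasure hf hΞ hΞs h1)
  have hc : ‖Function.rightLim f x - Function.leftLim f x‖ₑ ≠ 0 := by
    simpa [sub_eq_zero] using hx.symm
  rw [integrable_smul_measure hc enorm_ne_top] at h2
  exact (integrable_map_measure h2.aestronglyMeasurable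
    measurable_prodMk_left.aemeasurable).1 h2

/-- The point mass of the spectral measure is the weak limit of `-iy R_{x + iy}(K)`. -/
lemma ProjectionValuedMeasure.IsSpectralMeasureOf.tendsto_inner_smul_resolventOp
    (hE : E.IsSpectralMeasureOf K) (hK : IsSelfAdjoint K) (x : ℝ) (φ ψ : H) :
    Tendsto (fun y : ℝ => inner ℂ φ ((-(Complex.I * y) • resolventOp K (x + Complex.I * y)) ψ))
      (𝓝[>] 0) (𝓝 (inner ℂ φ (E.proj {x} ψ))) := by
  refine tendsto_inner_apply_of_tendsto_inner_self (fun ψ => ?_) φ ψ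
  have hx := isIntegral_proj (E := E) (measurableSet_singleton x) ψ
  have hne {y : ℝ} (hy : y ∈ Ioi (0 : ℝ)) : ((x : ℂ) + Complex.I * y).im ≠ 0 := by
    rw [im_add_I_mul (x, y)]
    exact ne_of_gt hy
  have heq : (fun y : ℝ =>
      inner ℂ ψ ((-(Complex.I * y) • resolventOp K (x + Complex.I * y)) ψ)) =ᶠ[𝓝[>] 0]
      fun y : ℝ => ∫ l, -(Complex.I * y) * cauchyKernel l (x, y) ∂(E.measure ψ) := by
    filter_upwards [self_mem_nhdsWithin] with y hy
    rw [_root_.smul_apply, inner_smul_right, (hE.isIntegral_resolventOp hK (hne hy) ψ).2,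
      ← integral_const_mul]
    rfl
  rw [hx.2]
  refine (tendsto_congr' heq).2 ?_
  refine tendsto_integral_filter_of_dominated_convergence (fun _ => 1) ?_ ?_
    (integrable_const _) ?_
  · refine Eventually.of_forall fun y => Measurable.aestronglyMeasurable ?_
    unfold cauchyKernel
    fun_prop
  · filter_upwards [self_mem_nhdsWithin] with y hy
    refine Eventually.of_forall fun l => ?_
    have h1 := norm_inv_sub_le (hne hy) l
    rw [im_add_I_mul (x, y)] at h1
    rw [norm_mul, norm_neg, norm_mul, Complex.norm_I, one_mul, Complex.norm_real, Real.norm_eq_abs]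
    refine (mul_le_mul_of_nonneg_left h1 (abs_nonneg y)).trans (le_of_eq ?_)
    exact mul_inv_cancel₀ (abs_ne_zero.2 (ne_of_gt hy))
  -- The function `-iy (l - x - iy)⁻¹` is identically `1` at `l = x` and tends to `0` elsewhere.
  · refine Eventually.of_forall fun l => ?_
    rcases eq_or_ne l x with rfl | hl
    · rw [indicator_of_mem (mem_singleton l), Pi.one_apply]
      refine tendsto_const_nhds.congr' ?_
      filter_upwards [self_mem_nhdsWithin] with y hy
      have h0 : -(Complex.I * (y : ℂ)) ≠ 0 := by
        simpa using ne_of_gt hy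
      rw [cauchyKernel, show (l : ℂ) - (((l, y) : ℝ × ℝ).1 + Complex.I * ((l, y) : ℝ × ℝ).2) =
        -(Complex.I * (y : ℂ)) by simp, mul_inv_cancel₀ h0]
    · rw [indicator_of_notMem (by simpa using hl)]
      have h0 : (l : ℂ) - (x + Complex.I * (0 : ℝ)) ≠ 0 := by
        simpa [sub_eq_zero] using hl
      have hc : ContinuousAt (fun y : ℝ => -(Complex.I * y) *
          ((l : ℂ) - (x + Complex.I * y))⁻¹) 0 := by
        refine ContinuousAt.mul (by fun_prop) (ContinuousAt.inv₀ (by fun_prop) h0)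
      have h1 := hc.tendsto.mono_left (nhdsWithin_le_nhds (s := Ioi 0))
      simpa [cauchyKernel] using h1

/-- At a point mass of `df`, integrability of `A R_z(K) B` with respect to `ζ_f` excludes an
eigenvalue of `K` that is seen by `A` and `B`. -/
theorem ProjectionValuedMeasure.IsSpectralMeasureOf.comp_proj_singleton_comp_eq_zero
    (hE : E.IsSpectralMeasureOf K) (hK : IsSelfAdjoint K) {x δ : ℝ} (hδ : 0 < δ)
    (hint : IntegrableOn (fun y : ℝ => A ∘L resolventOp K (x + Complex.I * y) ∘L B) (Ioo 0 δ)) :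
    A ∘L E.proj {x} ∘L B = 0 := by
  refine ContinuousLinearMap.ext fun ψ => ext_inner_left ℂ fun φ => ?_
  by_contra hne
  have hne' : inner ℂ φ ((A ∘L E.proj {x} ∘L B) ψ) ≠ 0 := fun h => hne (by simpa using h)
  have hlim := (hE.tendsto_inner_smul_resolventOp hK x
    (ContinuousLinearMap.adjoint A φ) (B ψ)).norm
  simp_rw [ContinuousLinearMap.adjoint_inner_left] at hlim
  set a : ℝ := ‖inner ℂ φ ((A ∘L E.proj {x} ∘L B) ψ)‖ with ha
  have hapos : 0 < a := norm_pos_iff.2 hne'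
  have hev := (hlim.eventually_const_lt (half_lt_self hapos)).and (Ioo_mem_nhdsGT hδ)
  obtain ⟨η, hη, hsub⟩ := mem_nhdsGT_iff_exists_Ioo_subset.1 hev
  have hη0 : 0 < η := hη
  have hηδ : Ioo 0 η ⊆ Ioo 0 δ := fun y hy => (hsub hy).2
  -- For small `y` the matrix element of `-iy A R B` exceeds half its limit `a > 0`. Dividing by `y`
  -- bounds `1/y` by an integrable function, which is impossible near `0`.
  have hbound : ∀ y ∈ Ioo 0 η, ‖y⁻¹‖ ≤ (2 / a * (‖φ‖ * ‖ψ‖)) *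
      ‖A ∘L resolventOp K (x + Complex.I * y) ∘L B‖ := by
    intro y hy
    have h1 : a / 2 < ‖inner ℂ φ (A ((-(Complex.I * y) • resolventOp K (x + Complex.I * y)) (B ψ)))‖ :=
      (hsub hy).1
    have h2 : ‖inner ℂ φ (A ((-(Complex.I * y) • resolventOp K (x + Complex.I * y)) (B ψ)))‖ ≤
        y * (‖φ‖ * (‖A ∘L resolventOp K (x + Complex.I * y) ∘L B‖ * ‖ψ‖)) := by
      rw [_root_.smul_apply, map_smul, inner_smul_right, norm_mul, norm_neg, norm_mul,
        Complex.norm_I, one_mul, Complex.norm_real, Real.norm_of_nonneg hy.1.le]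
      refine mul_le_mul_of_nonneg_left ((norm_inner_le_norm _ _).trans ?_) hy.1.le
      exact mul_le_mul_of_nonneg_left
        ((A ∘L resolventOp K (x + Complex.I * y) ∘L B).le_opNorm ψ) (norm_nonneg _)
    rw [norm_inv, Real.norm_of_nonneg hy.1.le, inv_le_iff_one_le_mul₀ hy.1]
    have h3 := h1.le.trans h2
    calc (1 : ℝ) = 2 / a * (a / 2) := by field_simp
      _ ≤ 2 / a * (y * (‖φ‖ * (‖A ∘L resolventOp K (x + Complex.I * y) ∘L B‖ * ‖ψ‖))) :=
        mul_le_mul_of_nonneg_left h3 (by positivity)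
      _ = _ := by ring
  have hinv : IntegrableOn (fun y : ℝ => y⁻¹) (Ioo 0 η) :=
    ((hint.mono_set hηδ).norm.const_mul _).mono' measurable_inv.aestronglyMeasurable
      ((ae_restrict_iff' measurableSet_Ioo).2 (Eventually.of_forall hbound))
  have h4 : IntervalIntegrable (fun y : ℝ => y⁻¹) volume 0 η :=
    (intervalIntegrable_iff_integrableOn_Ioo_of_le hη0.le).2 hinv
  rcases intervalIntegrable_inv_iff.1 h4 with h5 | h5
  · exact hη0.ne h5
  · exact h5 left_mem_uIcc

end Jump

/-! ### Conclusion: from the averaged function back to `f`. -/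

theorem lemma4p1 {H : Type*} [NormedAddCommGroup H] [InnerProductSpace ℂ H] [CompleteSpace H]
    (f : ℝ → ℝ) (hf : BoundedVariationOn f univ) (hf_supp : HasCompactSupport f)
    (hf_jump : HasOnlyJumpDiscontinuities f)
    (Ξ : ℝ × ℝ → ℂ) (hΞ_smooth : ContDiff ℝ ∞ Ξ) (hΞ_supp : HasCompactSupport Ξ)
    (hΞ_one : ∀ᶠ p in 𝓝ˢ (tsupport f ×ˢ ({0} : Set ℝ)), Ξ p = 1)
    (K : H →ₗ.[ℂ] H) (hK : IsSelfAdjoint K) (A B : H →L[ℂ] H)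
    (hfin : ∫⁻ p, ‖A ∘L resolventOp K (p.1 + Complex.I * p.2) ∘L B‖ₑ
      ∂(zetaMeasure hf Ξ).variation < ⊤) :
    Integrable (fun p : ℝ × ℝ => A ∘L resolventOp K (p.1 + Complex.I * p.2) ∘L B)
        (zetaMeasure hf Ξ).variation ∧
      A ∘L borelFunction K (fun l => (f l : ℂ)) ∘L B =
        (1 / (2 * Real.pi) : ℂ) • complexMeasureIntegral (zetaMeasure hf Ξ)
          (fun p : ℝ × ℝ => A ∘L resolventOp K (p.1 + Complex.I * p.2) ∘L B) := by
  have hint := integrable_comp_resolventOp_comp hf hΞ_smooth hΞ_supp hK hfin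
  refine ⟨hint, ?_⟩
  have hex := hK.exists_isSpectralMeasureOf
  rw [borelFunction, dif_pos hex]
  have hE : hex.choose.IsSpectralMeasureOf K := hex.choose_spec
  -- No property of the chosen `E` is needed beyond its being a spectral measure of `K`.
  set E := hex.choose
  obtain ⟨M, hM⟩ := hf.exists_abs_le
  have hfm : Measurable fun l => (f l : ℂ) := Complex.measurable_ofReal.comp hf.measurable
  have hgm : Measurable fun l => (limAverage f l : ℂ) :=
    Complex.measurable_ofReal.comp hf.measurable_limAverage
  have hfb (l : ℝ) : ‖(f l : ℂ)‖ ≤ M := by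
    rw [Complex.norm_real]
    exact hM l
  have hgb (l : ℝ) : ‖(limAverage f l : ℂ)‖ ≤ M := by
    rw [Complex.norm_real]
    exact hf.abs_limAverage_le hM l
  obtain ⟨T, hT⟩ := E.exists_isIntegral hfm hfb
  obtain ⟨S, hS⟩ := E.exists_isIntegral hgm hgb
  rw [hT.integral_eq, ← hE.comp_limAverage_comp_eq hK hf hf_supp hΞ_smooth hΞ_supp hΞ_one hS hint]
  -- `f` and its average agree at continuity points; at each of the countably many remaining points,
  -- the jump hypothesis forces `A E({x}) B = 0`.
  have hTS : A ∘L (T - S) ∘L B = 0 := by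
    refine ProjectionValuedMeasure.comp_isIntegral_comp_eq_zero (hT.sub hS) (hfm.sub hgm)
      (C := M + M) (fun l => (norm_sub_le _ _).trans (add_le_add (hfb l) (hgb l)))
      hf.countable_not_continuousAt ?_ A B ?_
    · intro l hl
      have hl' : ContinuousAt f l := not_not.1 hl
      simp [limAverage_eq_of_continuousAt hl']
    · intro x hx
      obtain ⟨δ, hδ, hone⟩ := eventually_eq_one_of_nhdsSet hf_supp hΞ_one
      exact hE.comp_proj_singleton_comp_eq_zero hK hδ
        (integrableOn_resolventOp_vertical hf hΞ_smooth hΞ_supp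
          (fun y hy => hone y hy x (mem_tsupport_of_not_continuousAt hx)) (hf_jump x hx) hint)
  rw [ContinuousLinearMap.sub_comp, ContinuousLinearMap.comp_sub, sub_eq_zero] at hTS
  exact hTS
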